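/- Let $X$ be a Hausdorff, path-connected, locally path-connected and semi-locally simply connected space, and let $\mathcal C(X)$ be the ring of continuous functions $X\to\mathbb C$. Let $f\in\mathcal C(X)[z]$ be a Weierstrass polynomial of degree $n$: $f$ is monic of degree $n$ and, for every $x\in X$, the complex polynomial $f_x$ has $n$ distinct roots. For a covering $p:Y\to X$ with $Y$ path-connected, a root of $p^*f$ is a continuous $\beta:Y\to\mathbb C$ with $f_{p(y)}(\beta(y))=0$ for all $y\in Y$, and $f$ splits in $Y$ if $p^*f$ has $n$ distinct roots. Let $q:E_f\to X$ be a splitting covering of $f$, that is, a path-connected covering in which $f$ splits and such that for every path-connected covering $p:Y\to X$ in which $f$ splits there is a covering map $\pi:Y\to E_f$ with $q\pi=p$. Let $e_0\in E_f$, $x_0=q(e_0)$, and let $\alpha_1,\dots,\alpha_n\in\mathcal C(E_f)$ be the $n$ distinct roots of $q^*f$. For a covering $r:Y\to Z$ let $A(Y/Z)$ be the group of homeomorphisms $\Phi:Y\to Y$ with $r\Phi=r$. Put $R=q^*\mathcal C(X)=\{\gamma\circ q:\gamma\in\mathcal C(X)\}\subset\mathcal C(E_f)$ and $G_f=\mathrm{Aut}_R(R[\alpha_1,\dots,\alpha_n])$.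 For $I=(i_1,\dots,i_n)$ with $0\le i_k\le n-k$ put $\alpha^I=\alpha_1^{i_1}\cdots\alpha_n^{i_n}$ and $\sigma^I=\sigma_1^{i_1}\cdots\sigma_n^{i_n}\in S_n$, where $\sigma_k$ is the cycle $(k\ k{+}1\ \cdots\ n)$, and let $$\Delta=\det\Bigl(\prod_{k=1}^n\alpha_{\sigma^I(k)}^{j_k}\Bigr)_{I,J}\in\mathcal C(E_f)$$ be the determinant of the $n!\times n!$ matrix with rows $I$ and columns $J=(j_1,\dots,j_n)$ running over these multi-indices in the same order (the $(I,J)$ entry is $\sigma^I$ applied to $\alpha^J$). Let $T$ be a subring of $R$ that contains the coefficients of $q^*f$, such that $T[\alpha_1,\dots,\alpha_n]\cap R=T$ and $1/\Delta\in T[\alpha_1,\dots,\alpha_n]$ (that is, $\Delta$ has an inverse in $\mathcal C(E_f)$ that lies in this subring). Write $T[\alpha]=T[\alpha_1,\dots,\alpha_n]$ and $G=\mathrm{Aut}_T(T[\alpha])$. Then: 1. $\omega(\Phi)(\beta)=\beta\circ\Phi^{-1}$ defines a group isomorphism $\omega:A(E_f/X)\to G$. 2. There are one-to-one correspondences $$(L,l_0)\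 \longleftrightarrow\ H=A(E_f/L)\ \longleftrightarrow\ H'=\omega(H)\ \longleftrightarrow\ L'=T[\alpha]^{H'}$$ between - isomorphism classes of based path-connected covering spaces between $(E_f,e_0)$ and $(X,x_0)$, that is, based coverings $(E_f,e_0)\to(L,l_0)\to(X,x_0)$ with composite $q$, up to based isomorphism over $X$, - subgroups $H$ of $A(E_f/X)$, - subgroups $H'$ of $G$, and - separable $T$-subalgebras $L'$ of $T[\alpha]$ ($L'$ is projective as an $L'\otimes_T L'$-module); the inverse of the last correspondence is $L'\mapsto G_{L'}=\{\phi\in G:\phi|_{L'}=\mathrm{id}\}$. If $(L,l_0)$, $(M,m_0)$ correspond to $H,H',L'$ and $J,J',M'$ respectively, then there is a based covering map $(L,l_0)\to(M,m_0)$ over $X$ if and only if $H\subset J$, if and only if $H'\subset J'$, if and only if $L'\supset M'$. The covering $E_f$ corresponds to the trivial subgroups and to $T[\alpha]$, and $X$ corresponds to $A(E_f/X)$, $G$ and $T$. Moreover, for every based covering map $(L,l_0)\to(M,m_0)$ over $X$ all fibres are finite, of cardinality $[L:M]=[J:H]=[J':H']$. In particular (taking $T=R$, for which no further hypothesis is needed)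 $\omega$ gives an isomorphism $A(E_f/X)\cong G_f$. -/

import Mathlib

open Polynomial TensorProduct Topology

universe u

noncomputable section

namespace SemiTopGalois

/-- Every point `x` has a neighbourhood `U` such that all loops at `x` inside `U` are
null-homotopic in `X`. -/
def SemilocallySimplyConnected (X : Type*) [TopologicalSpace X] : Prop :=
  ∀ x : X, ∃ U ∈ 𝓝 x, ∀ γ : Path x x, Set.range γ ⊆ U → γ.Homotopic (Path.refl x)

/-! ### Weierstrass polynomials, roots, splitting coverings -/

/-- The complex polynomial `f_x`, for `f ∈ C(X)[z]` and `x ∈ X`. -/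
def fiberPoly {X : Type*} [TopologicalSpace X] (f : C(X, ℂ)[X]) (x : X) : ℂ[X] :=
  f.map (ContinuousMap.evalAlgHom ℂ ℂ x : C(X, ℂ) →ₐ[ℂ] ℂ).toRingHom

/-- `f` is monic of degree `n` and each `f_x` has exactly `n` distinct roots. -/
structure IsWeierstrass {X : Type*} [TopologicalSpace X] (f : C(X, ℂ)[X]) (n : ℕ) : Prop where
  monic : f.Monic
  natDegree_eq : f.natDegree = n
  ncard_roots : ∀ x : X, {z : ℂ | (fiberPoly f x).eval z = 0}.ncard = n

/-- The pullback `q* : C(X) → C(Y)`, `γ ↦ γ ∘ q`. -/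
def pullback {X Y : Type*} [TopologicalSpace X] [TopologicalSpace Y] (q : C(Y, X)) :
    C(X, ℂ) →+* C(Y, ℂ) :=
  (ContinuousMap.compRightAlgHom ℂ ℂ q).toRingHom

/-- A root of `f` on `X`: a continuous function `β` with `f_x(β(x)) = 0` for all `x`. -/
def IsFunRoot {X : Type*} [TopologicalSpace X] (f : C(X, ℂ)[X]) (β : C(X, ℂ)) : Prop :=
  ∀ x : X, (fiberPoly f x).eval (β x) = 0

/-- `α` lists `n` distinct roots of `q* f` on `Y`. -/
structure IsRootList {X Y : Type*} [TopologicalSpace X] [TopologicalSpace Y] (q : C(Y, X))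
    (f : C(X, ℂ)[X]) {n : ℕ} (α : Fin n → C(Y, ℂ)) : Prop where
  injective : Function.Injective α
  isFunRoot : ∀ i, IsFunRoot (f.map (pullback q)) (α i)

/-- `f` (of degree `n`) splits in `Y` (along `q : Y → X`). -/
def SplitsIn {X Y : Type*} [TopologicalSpace X] [TopologicalSpace Y] (q : C(Y, X))
    (f : C(X, ℂ)[X]) (n : ℕ) : Prop :=
  ∃ α : Fin n → C(Y, ℂ), IsRootList q f α

/-- `q : E → X` is a splitting covering of `f`: a path-connected covering in which `f` splits and
which is covered, over `X`, by every other path-connected covering in which `f` splits. -/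
structure IsSplittingCovering {X E : Type u} [TopologicalSpace X] [TopologicalSpace E]
    (q : C(E, X)) (f : C(X, ℂ)[X]) (n : ℕ) : Prop where
  isCoveringMap : IsCoveringMap q
  pathConnected : PathConnectedSpace E
  splits : SplitsIn q f n
  minimal : ∀ (Y : Type u) [TopologicalSpace Y] [PathConnectedSpace Y] (p : C(Y, X)),
    IsCoveringMap p → SplitsIn p f n → ∃ π : C(Y, E), IsCoveringMap π ∧ q.comp π = p

/-! ### Covering transformations -/

/-- The group `A(Y/X)` of covering transformations of `q : Y → X`. -/
def deck {X Y : Type*} [TopologicalSpace X] [TopologicalSpace Y] (q : C(Y, X)) :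
    Subgroup (Y ≃ₜ Y) where
  carrier := {Φ | ∀ y, q (Φ y) = q y}
  mul_mem' {a b} ha hb y := (ha (b y)).trans (hb y)
  one_mem' _ := rfl
  inv_mem' {a} ha y := by
    have h := ha (a.symm y)
    rw [a.apply_symm_apply] at h
    exact h.symm

theorem isCoveringMap_id (X : Type*) [TopologicalSpace X] :
    IsCoveringMap (ContinuousMap.id X) := fun _ =>
  IsEvenlyCovered.to_isEvenlyCovered_preimage (I := PUnit.{1})
    ⟨inferInstance, Set.univ, trivial, isOpen_univ, isOpen_univ,
      (Homeomorph.prodPUnit (Set.univ : Set X)).symm, fun _ => rfl⟩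

/-- A based covering space `(L, l₀)` between `(E, e₀)` and `X`:
based coverings `(E, e₀) → (L, l₀) → (X, q e₀)` with composite `q` and `L` path-connected. -/
structure IntermediateCovering {X E : Type u} [TopologicalSpace X] [TopologicalSpace E]
    (q : C(E, X)) (e₀ : E) where
  carrier : Type u
  [top : TopologicalSpace carrier]
  [pathConnected : PathConnectedSpace carrier]
  point : carrier
  fromTop : C(E, carrier)
  toBase : C(carrier, X)
  isCoveringMap_fromTop : IsCoveringMap fromTop
  isCoveringMap_toBase : IsCoveringMap toBase
  comp_eq : toBase.comp fromTop = q
  map_point : fromTop e₀ = point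

attribute [instance] IntermediateCovering.top IntermediateCovering.pathConnected

namespace IntermediateCovering

variable {X E : Type u} [TopologicalSpace X] [TopologicalSpace E] {q : C(E, X)} {e₀ : E}

/-- `s : (L, l₀) → (M, m₀)` is a based covering map over `X`. -/
structure IsCoveringOver (L M : IntermediateCovering q e₀) (s : C(L.carrier, M.carrier)) :
    Prop where
  isCoveringMap : IsCoveringMap s
  comp_eq : M.toBase.comp s = L.toBase
  map_point : s L.point = M.point

/-- Isomorphism of based covering spaces of `X`. -/
def Iso (L M : IntermediateCovering q e₀) : Prop :=
  ∃ h : L.carrier ≃ₜ M.carrier, (∀ l, M.toBase (h l) = L.toBase l) ∧ h L.point = M.point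

variable (q e₀) in
/-- Isomorphism of intermediate coverings, as an equivalence relation. -/
def isoSetoid : Setoid (IntermediateCovering q e₀) where
  r := Iso
  iseqv :=
    { refl := fun L => ⟨Homeomorph.refl _, fun _ => rfl, rfl⟩
      symm := by
        rintro L M ⟨h, h₁, h₂⟩
        refine ⟨h.symm, fun m => ?_, ?_⟩
        · rw [← h₁, h.apply_symm_apply]
        · rw [← h₂, h.symm_apply_apply]
      trans := by
        rintro L M N ⟨h, h₁, h₂⟩ ⟨k, k₁, k₂⟩
        refine ⟨h.trans k, fun l => ?_, ?_⟩
        · rw [Homeomorph.trans_apply, k₁, h₁]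
        · rw [Homeomorph.trans_apply, h₂, k₂] }

/-- The subgroup `A(E/L)` of `A(E/X)`. -/
def deckOver (L : IntermediateCovering q e₀) : Subgroup (deck q) :=
  (deck L.fromTop).subgroupOf (deck q)

variable (e₀) in
/-- `E` itself as an intermediate covering. -/
def self (hE : PathConnectedSpace E) (hq : IsCoveringMap q) : IntermediateCovering q e₀ where
  carrier := E
  point := e₀
  fromTop := ContinuousMap.id E
  toBase := q
  isCoveringMap_fromTop := isCoveringMap_id E
  isCoveringMap_toBase := hq
  comp_eq := by ext; rfl
  map_point := rfl

variable (e₀) in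
/-- `X` itself as an intermediate covering. -/
def base [PathConnectedSpace X] (hq : IsCoveringMap q) : IntermediateCovering q e₀ where
  carrier := X
  point := q e₀
  fromTop := q
  toBase := ContinuousMap.id X
  isCoveringMap_fromTop := hq
  isCoveringMap_toBase := isCoveringMap_id X
  comp_eq := by ext; rfl
  map_point := rfl

end IntermediateCovering

/-! ### The function `Δ` -/

/-- The set of multi-indices `(i₁, …, iₙ)` with `0 ≤ i_k ≤ n - k`. With indices starting from `0`
the `k`-th entry is `< n - k`; the last entry is always zero. -/
abbrev MultiIndex (n : ℕ) : Type := (k : Fin n) → Fin (n - k)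

/-- The cycle `σ_k = (k  k+1  …  n)`. -/
def cyc {n : ℕ} (k : Fin n) : Equiv.Perm (Fin n) :=
  Fin.cycleIcc k ⟨n - 1, Nat.sub_one_lt_of_lt k.2⟩

/-- `σ^I = σ₁^{i₁} σ₂^{i₂} ⋯ σₙ^{iₙ}`. -/
def sigmaPow {n : ℕ} (I : MultiIndex n) : Equiv.Perm (Fin n) :=
  (List.ofFn fun k => cyc k ^ (I k : ℕ)).prod

/-- The matrix `(φ_I(x_J))` with `x_J = α^J` and `φ_I = σ^I` acting by permuting the `α`'s. -/
def vMatrix {A : Type*} [CommRing A] {n : ℕ} (α : Fin n → A) :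
    Matrix (MultiIndex n) (MultiIndex n) A :=
  Matrix.of fun I J => ∏ k, α (sigmaPow I k) ^ (J k : ℕ)

/-- `Δ = det (φ_I(x_J))`. -/
def Delta {A : Type*} [CommRing A] {n : ℕ} (α : Fin n → A) : A :=
  (vMatrix α).det

/-! ### Rings -/

/-- `S` is a separable `R`-algebra: `S` is projective as a module over `S ⊗_R S`
(acting through multiplication). -/
def IsSeparableAlgebra (R S : Type*) [CommRing R] [CommRing S] [Algebra R S] : Prop :=
  letI : Module (S ⊗[R] S) S :=
    Module.compHom S (Algebra.TensorProduct.lmul' R : S ⊗[R] S →ₐ[R] S).toRingHom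
  Module.Projective (S ⊗[R] S) S

/-- The separable `R`-subalgebras of `S`, ordered by inclusion. -/
abbrev SepSubalgebra (R S : Type*) [CommRing R] [CommRing S] [Algebra R S] : Type _ :=
  {L : Subalgebra R S // IsSeparableAlgebra R L}

/-- `T[α₁, …, αₙ]`. -/
abbrev adjoinRoots {A : Type*} [CommRing A] (T : Subring A) {n : ℕ} (α : Fin n → A) :
    Subalgebra T A :=
  Algebra.adjoin T (Set.range α)

/-- `Aut_T T[α₁, …, αₙ]`. -/
abbrev autGroup {A : Type*} [CommRing A] (T : Subring A) {n : ℕ} (α : Fin n → A) : Type _ :=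
  adjoinRoots T α ≃ₐ[T] adjoinRoots T α

/-- The isomorphism `ω : A(E/X) ≃ Aut_T T[α]` acts by `ω(Φ)(β) = β ∘ Φ⁻¹`. -/
def IsOmega {X E : Type*} [TopologicalSpace X] [TopologicalSpace E] (q : C(E, X))
    (T : Subring C(E, ℂ)) {n : ℕ} (α : Fin n → C(E, ℂ)) (ω : deck q ≃* autGroup T α) : Prop :=
  ∀ (Φ : deck q) (β : adjoinRoots T α) (y : E),
    (ω Φ β : C(E, ℂ)) y = (β : C(E, ℂ)) ((Φ : E ≃ₜ E).symm y)

end SemiTopGalois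

end

open SemiTopGalois

/-!
Sending `e` to the ordered roots `(α₁ e, …, αₙ e)` of `f` at `q e` maps `E` into the covering of
`X` by orderings of roots. By minimality of `E` this map is injective, and it identifies `E` with
a connected component. Reordering the roots then moves `E` onto itself, so the covering
transformations act transitively on the fibres: `q` is the quotient by the finite group `A(E/X)`,
and the intermediate coverings are the quotients by its subgroups.

On the algebraic side `T[α]` has no idempotents besides `0` and `1`, because `E` is connected, and
its `A(E/X)`-invariants are `T`. Every `φ ∈ Aut_T T[α]` agrees at a point `e` with some `ω(Φ)`:
both `β ↦ β e` and `β ↦ (φ β) e` are roots of orbit polynomials over `T`. Roots agreeing at one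
point are equal, so `φ = ω(Φ)`. Invertibility of `Δ` makes all `αᵢ - αⱼ` units, so products of
the elements `(α ⊗ 1 - 1 ⊗ g α) / (α - g α)` separate the elements of the group. This is a system
of Galois coordinates, which for every subgroup yields a separability idempotent of its ring of
invariants. Conversely, the images of the separability idempotent of a subalgebra `L` under
`a ⊗ b ↦ a * g b` are idempotents, hence `0` or `1`, and `1` exactly when `g` fixes `L`.
-/

noncomputable section

namespace SemiTopGalois

/-! ### Separable algebras -/

theorem projective_iff_exists_mul_eq_zero {A S : Type*} [CommRing A] [CommRing S] [Algebra A S]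
    (h : Function.Surjective (algebraMap A S)) :
    Module.Projective A S ↔
      ∃ e : A, algebraMap A S e = 1 ∧ ∀ w ∈ RingHom.ker (algebraMap A S), w * e = 0 := by
  constructor
  · intro _
    obtain ⟨σ, hσ⟩ := Module.projective_lifting_property (Algebra.linearMap A S) LinearMap.id h
    refine ⟨σ 1, DFunLike.congr_fun hσ 1, fun w hw => ?_⟩
    rw [← smul_eq_mul, ← map_smul, Algebra.smul_def, (RingHom.mem_ker).1 hw, zero_mul, map_zero]
  · rintro ⟨e, he, hker⟩
    have hwell {a b : A} (hab : algebraMap A S a = algebraMap A S b) : a * e = b * e := by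
      rw [← sub_eq_zero, ← sub_mul]
      exact hker _ (by rw [RingHom.mem_ker, map_sub, hab, sub_self])
    have hinv := Function.surjInv_eq h
    let σ : S →ₗ[A] A :=
      { toFun := fun s => Function.surjInv h s * e
        map_add' := fun s t => by
          rw [← add_mul]
          exact hwell (by simp only [map_add, hinv])
        map_smul' := fun a s => by
          rw [RingHom.id_apply, smul_eq_mul, ← mul_assoc]
          exact hwell (by simp only [map_mul, hinv, Algebra.smul_def]) }
    refine Module.Projective.of_split σ (Algebra.linearMap A S) (LinearMap.ext fun s => ?_)
    simp [σ, he, hinv]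

/-- A separability idempotent of the `R`-algebra `S`: an element of `S ⊗ S` on which the two
`S`-module structures agree and whose product is `1`. -/
structure IsSeparabilityIdempotent {R S : Type*} [CommRing R] [CommRing S] [Algebra R S]
    (e : S ⊗[R] S) : Prop where
  lmul'_eq_one : Algebra.TensorProduct.lmul' R e = 1
  tmul_one_mul : ∀ s : S, (s ⊗ₜ[R] (1 : S)) * e = ((1 : S) ⊗ₜ[R] s) * e

section SeparabilityIdempotent

variable {R S : Type*} [CommRing R] [CommRing S] [Algebra R S]

theorem IsSeparabilityIdempotent.mul_eq_zero {e : S ⊗[R] S} (he : IsSeparabilityIdempotent e)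
    {w : S ⊗[R] S} (hw : w ∈ KaehlerDifferential.ideal R S) : w * e = 0 := by
  suffices KaehlerDifferential.ideal R S ≤ LinearMap.ker (LinearMap.mulRight (S ⊗[R] S) e) from
    this hw
  rw [← KaehlerDifferential.span_range_eq_ideal, Ideal.span_le]
  rintro _ ⟨s, rfl⟩
  simp [sub_mul, he.tmul_one_mul]

theorem IsSeparabilityIdempotent.isIdempotentElem {e : S ⊗[R] S}
    (he : IsSeparabilityIdempotent e) : IsIdempotentElem e := by
  have : (e - 1) * e = 0 := he.mul_eq_zero (by
    rw [KaehlerDifferential.ideal, RingHom.mem_ker, map_sub, map_one]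
    simp [he.lmul'_eq_one])
  rwa [sub_mul, one_mul, sub_eq_zero] at this

theorem isSeparableAlgebra_iff_exists_isSeparabilityIdempotent :
    IsSeparableAlgebra R S ↔ ∃ e : S ⊗[R] S, IsSeparabilityIdempotent e := by
  let _ : Algebra (S ⊗[R] S) S := (Algebra.TensorProduct.lmul' R).toRingHom.toAlgebra
  have hsurj : Function.Surjective (algebraMap (S ⊗[R] S) S) :=
    fun s => ⟨s ⊗ₜ 1, (Algebra.TensorProduct.lmul'_apply_tmul s 1).trans (mul_one s)⟩
  refine (projective_iff_exists_mul_eq_zero hsurj).trans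
    ⟨fun ⟨e, he, hker⟩ => ⟨e, he, fun s => ?_⟩,
      fun ⟨e, he⟩ => ⟨e, he.lmul'_eq_one, fun w hw => he.mul_eq_zero hw⟩⟩
  rw [← sub_eq_zero, ← sub_mul]
  refine hker _ (RingHom.mem_ker.2 ?_)
  simp [RingHom.algebraMap_toAlgebra]

end SeparabilityIdempotent

/-! ### The Galois correspondence for separable subalgebras -/

/-- The polynomial `∑ sᵢ zⁱ` packs the finitely many `sᵢ` into one element, and `K[z]` is still a
domain, so a root of its orbit polynomial is one of its conjugates. -/
theorem exists_forall_eq_of_eq_on_invariants {S K D : Type*} [CommRing S] [CommRing K] [IsDomain K]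
    [Group D] [Finite D] [MulSemiringAction D S] {a b : S →+* K}
    (h : ∀ s : S, (∀ g : D, g • s = s) → a s = b s) {n : ℕ} (s : Fin n → S) :
    ∃ g : D, ∀ i, b (s i) = a (g • s i) := by
  have := Fintype.ofFinite D
  let p : S[X] := ∑ i : Fin n, monomial (i : ℕ) (s i)
  have hcoeff (i : Fin n) : p.coeff i = s i := by
    simp [p, coeff_monomial, Fin.val_inj]
  have hmap : (MulSemiringAction.charpoly D p).map (mapRingHom a) =
      (MulSemiringAction.charpoly D p).map (mapRingHom b) := by
    ext k m
    simp only [coeff_map, coe_mapRingHom]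
    refine h _ fun g => ?_
    rw [← coeff_smul, MulSemiringAction.smul_coeff_charpoly]
  have hroot : ((MulSemiringAction.charpoly D p).map (mapRingHom a)).eval (mapRingHom b p) = 0 := by
    rw [hmap, eval_map, eval₂_hom, MulSemiringAction.eval_charpoly, map_zero]
  rw [MulSemiringAction.charpoly_eq, Polynomial.map_prod, eval_prod,
    Finset.prod_eq_zero_iff] at hroot
  obtain ⟨g, -, hg⟩ := hroot
  have hconj : p.map b = (g • p).map a := by simpa [sub_eq_zero] using hg
  refine ⟨g, fun i => ?_⟩
  simpa [coeff_map, hcoeff] using congrArg (fun r : K[X] => r.coeff i) hconj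

section TwistedMul

variable {T A S G : Type*} [CommRing T] [CommRing A] [CommRing S] [Algebra T A] [Algebra T S]
  [Group G] [MulSemiringAction G S] [SMulCommClass G T S] (j : A →ₐ[T] S)

/-- The map `A ⊗ A → S`, `a ⊗ b ↦ a * g b`. For `A = S` these are the components of the map
`S ⊗ S → ∏_g S` whose bijectivity characterises Galois extensions. -/
def twistedMul (g : G) : A ⊗[T] A →ₐ[T] S :=
  Algebra.TensorProduct.lift j ((MulSemiringAction.toAlgHom T S g).comp j)
    fun _ _ => Commute.all _ _

@[simp]
theorem twistedMul_tmul (g : G) (a b : A) : twistedMul j g (a ⊗ₜ[T] b) = j a * g • j b := by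
  simp [twistedMul]

/-- `w` *indicates* the subgroup `H` if `a ⊗ b ↦ a * g b` sends it to `1` for `g ∈ H` and to `0`
otherwise. If `w = ∑ aᵢ ⊗ bᵢ` in `S ⊗ S` indicates the trivial subgroup, the pairs `(aᵢ, bᵢ)` are
what is known as a system of Galois coordinates. -/
structure Indicates (H : Subgroup G) (w : A ⊗[T] A) : Prop where
  eq_one : ∀ g ∈ H, twistedMul j g w = 1
  eq_zero : ∀ g ∉ H, twistedMul j g w = 0

variable {j}

theorem twistedMul_eq_lmul' {g : G} (hg : ∀ a, g • j a = j a) (w : A ⊗[T] A) :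
    twistedMul j g w = j (Algebra.TensorProduct.lmul' T w) := by
  suffices twistedMul j g = j.comp (Algebra.TensorProduct.lmul' T) from DFunLike.congr_fun this w
  ext a
  · simp [twistedMul]
  · simp [twistedMul, hg]

theorem sum_mul_sum_smul_eq_sum_twistedMul [Fintype G] {w : A ⊗[T] A} {C : Finset (A × A)}
    (hC : w = ∑ p ∈ C, p.1 ⊗ₜ p.2) (s : S) :
    ∑ p ∈ C, j p.1 * ∑ g : G, g • (j p.2 * s) = ∑ g : G, twistedMul j g w * g • s := by
  simp_rw [hC, map_sum, twistedMul_tmul, Finset.mul_sum, Finset.sum_mul, smul_mul', mul_assoc]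
  exact Finset.sum_comm

theorem Indicates.eq_ite {H : Subgroup G} [DecidablePred (· ∈ H)] {w : A ⊗[T] A}
    (hw : Indicates j H w) (g : G) : twistedMul j g w = if g ∈ H then 1 else 0 := by
  split_ifs with hg
  exacts [hw.eq_one g hg, hw.eq_zero g hg]

theorem Indicates.sum_mul_smul [Fintype G] {H : Subgroup G} [Fintype H] {w : A ⊗[T] A}
    (hw : Indicates j H w) (s : S) :
    ∑ g : G, twistedMul j g w * g • s = ∑ h : H, h • s := by
  classical
  simp_rw [hw.eq_ite, ite_mul, one_mul, zero_mul]
  rw [← Finset.sum_filter, Finset.sum_subtype (p := (· ∈ H)) _ (by simp)]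
  rfl

theorem Indicates.bot_of_subgroup {w : A ⊗[T] A} (hw : Indicates j (⊥ : Subgroup G) w)
    (H : Subgroup G) : Indicates j (⊥ : Subgroup H) w where
  eq_one h hh := hw.eq_one h (by simpa using hh)
  eq_zero h hh := hw.eq_zero h (by simpa using hh)

theorem Indicates.sum_mul_sum_smul_mul [Fintype G] {w : A ⊗[T] A}
    (hw : Indicates j (⊥ : Subgroup G) w) {C : Finset (A × A)} (hC : w = ∑ p ∈ C, p.1 ⊗ₜ p.2)
    (s : S) : ∑ p ∈ C, j p.1 * ∑ g : G, g • (j p.2 * s) = s := by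
  classical
  rw [sum_mul_sum_smul_eq_sum_twistedMul hC]
  simp_rw [hw.eq_ite, Subgroup.mem_bot, ite_mul, one_mul, zero_mul]
  simp

theorem exists_indicates_bot [Finite G] (h : ∀ g : G, g ≠ 1 → ∃ s : S, IsUnit (s - g • s)) :
    ∃ w : S ⊗[T] S, Indicates (AlgHom.id T S) (⊥ : Subgroup G) w := by
  have := Fintype.ofFinite G
  have h' (g : G) : ∃ w : S ⊗[T] S, twistedMul (AlgHom.id T S) (1 : G) w = 1 ∧
      (g ≠ 1 → twistedMul (AlgHom.id T S) g w = 0) := by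
    by_cases hg : g = 1
    · exact ⟨1, by simp, fun h => (h hg).elim⟩
    · obtain ⟨s, hs⟩ := h g hg
      obtain ⟨u, hu⟩ := hs.exists_right_inv
      refine ⟨u ⊗ₜ s - (u * g • s) ⊗ₜ 1, ?_, fun _ => ?_⟩
      · simp only [map_sub, twistedMul_tmul, AlgHom.id_apply, one_smul]
        linear_combination hu
      · simp
  choose w hw hw' using h'
  refine ⟨∏ g, w g, fun g hg => ?_, fun g hg => ?_⟩
  · rw [Subgroup.mem_bot.1 hg, map_prod, Finset.prod_eq_one fun g _ => hw g]
  · rw [map_prod, Finset.prod_eq_zero (Finset.mem_univ g) (hw' g (by simpa using hg))]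

end TwistedMul

section GaloisCorrespondence

variable {T S G : Type*} [CommRing T] [CommRing S] [Algebra T S] [Group G] [MulSemiringAction G S]
  [SMulCommClass G T S]

/-- The trace `s ↦ ∑ g s` of a finite group, as a map to the invariants. -/
def groupTrace (T S G : Type*) [CommRing T] [CommRing S] [Algebra T S] [Group G]
    [MulSemiringAction G S] [SMulCommClass G T S] [Fintype G] :
    S →ₗ[FixedPoints.subalgebra T S G] FixedPoints.subalgebra T S G where
  toFun s := ⟨∑ g : G, g • s, fun k => by
    simp only [Finset.smul_sum, ← mul_smul]
    exact Fintype.sum_equiv (Equiv.mulLeft k) _ _ fun _ => rfl⟩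
  map_add' s t := Subtype.ext (by simp [Finset.sum_add_distrib])
  map_smul' a s := Subtype.ext (by
    have ha (g : G) : g • (a : S) = a := a.2 g
    simp [Subalgebra.smul_def, smul_mul', ha, Finset.mul_sum])

@[simp]
theorem coe_groupTrace [Fintype G] (s : S) : (groupTrace T S G s : S) = ∑ g : G, g • s := rfl

theorem Indicates.exists_groupTrace_eq_one [Fintype G] {w : S ⊗[T] S}
    (hw : Indicates (AlgHom.id T S) (⊥ : Subgroup G) w) : ∃ c : S, groupTrace T S G c = 1 := by
  let F := FixedPoints.subalgebra T S G
  have : Algebra.IsInvariant F S G := ⟨fun s hs => ⟨⟨s, hs⟩, rfl⟩⟩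
  let I : Ideal F := LinearMap.range (groupTrace T S G)
  suffices hI : I = ⊤ from LinearMap.range_eq_top.1 hI 1
  have hker : RingHom.ker (algebraMap F S) ≤ I := fun t ht => by
    have : t = 0 := Subtype.ext ht
    simp [this]
  refine (Ideal.map_eq_top_iff_of_ker_le (algebraMap F S) hker
    (Algebra.IsInvariant.isIntegral F S G).isIntegral).1 ((Ideal.eq_top_iff_one _).2 ?_)
  obtain ⟨C, hC⟩ := TensorProduct.exists_finset w
  have hone : (1 : S) = ∑ p ∈ C, p.1 * ∑ g : G, g • p.2 := by
    simpa using (hw.sum_mul_sum_smul_mul hC 1).symm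
  rw [hone]
  exact Ideal.sum_mem _ fun p _ => Ideal.mul_mem_left _ _
    (Ideal.mem_map_of_mem (I := I) (algebraMap F S) ⟨p.2, rfl⟩)

theorem exists_algebraMap_eq_sum_smul [Fintype G] [Algebra.IsInvariant T S G] (s : S) :
    ∃ t : T, algebraMap T S t = ∑ g : G, g • s :=
  Algebra.IsInvariant.isInvariant (G := G) _ (groupTrace T S G s).2

theorem Indicates.sum_sum_tmul [Fintype G] [Algebra.IsInvariant T S G] {w : S ⊗[T] S}
    (hw : Indicates (AlgHom.id T S) (⊥ : Subgroup G) w) {C : Finset (S × S)}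
    (hC : w = ∑ p ∈ C, p.1 ⊗ₜ p.2) (v : S ⊗[T] S) :
    ∑ p ∈ C, (∑ g : G, g • p.2 * twistedMul (AlgHom.id T S) g v) ⊗ₜ[T] p.1 = v := by
  induction v with
  | zero => simp
  | add x y hx hy =>
    simp only [map_add, mul_add, Finset.sum_add_distrib, TensorProduct.add_tmul, hx, hy]
  | tmul a b =>
    choose t ht using exists_algebraMap_eq_sum_smul (T := T) (S := S) (G := G)
    have hp (p : S × S) : (∑ g : G, g • p.2 * twistedMul (AlgHom.id T S) g (a ⊗ₜ[T] b)) ⊗ₜ[T] p.1 =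
        a ⊗ₜ[T] (p.1 * ∑ g : G, g • (p.2 * b)) := by
      have : ∑ g : G, g • p.2 * twistedMul (AlgHom.id T S) g (a ⊗ₜ[T] b) = t (p.2 * b) • a := by
        rw [Algebra.smul_def, ht, Finset.sum_mul]
        refine Finset.sum_congr rfl fun g _ => ?_
        rw [twistedMul_tmul, AlgHom.id_apply, AlgHom.id_apply, smul_mul']
        ring
      rw [this, TensorProduct.smul_tmul, Algebra.smul_def, ht, mul_comm]
    simp_rw [hp]
    rw [← TensorProduct.tmul_sum]
    exact congrArg (a ⊗ₜ[T] ·) (hw.sum_mul_sum_smul_mul hC b)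

theorem Indicates.ext_of_twistedMul [Finite G] [Algebra.IsInvariant T S G] {w : S ⊗[T] S}
    (hw : Indicates (AlgHom.id T S) (⊥ : Subgroup G) w) {u v : S ⊗[T] S}
    (h : ∀ g : G, twistedMul (AlgHom.id T S) g u = twistedMul (AlgHom.id T S) g v) : u = v := by
  have := Fintype.ofFinite G
  obtain ⟨C, hC⟩ := TensorProduct.exists_finset w
  rw [← hw.sum_sum_tmul hC u, ← hw.sum_sum_tmul hC v]
  simp_rw [h]

theorem Indicates.isSeparabilityIdempotent [Finite G] [Algebra.IsInvariant T S G] {w : S ⊗[T] S}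
    (hw : Indicates (AlgHom.id T S) (⊥ : Subgroup G) w) : IsSeparabilityIdempotent w where
  lmul'_eq_one :=
    (twistedMul_eq_lmul' (j := AlgHom.id T S) (fun _ => one_smul G _) w).symm.trans
      (hw.eq_one 1 (one_mem _))
  tmul_one_mul s := hw.ext_of_twistedMul fun g => by
    obtain rfl | hg := eq_or_ne g 1
    · simp
    · rw [map_mul, map_mul, hw.eq_zero g (by simpa using hg), mul_zero, mul_zero]

section FixedPoints

variable (H : Subgroup G) [Fintype H]

/-- The map `a ⊗ b ↦ tr (c * a) ⊗ tr b` on `S ⊗ S`, where `tr` is the trace of `H`. If `tr c = 1`,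
it turns an element indicating the trivial subgroup into one indicating `H`. -/
def traceTensor (c : S) : S ⊗[T] S →ₗ[T]
    FixedPoints.subalgebra T S H ⊗[T] FixedPoints.subalgebra T S H :=
  TensorProduct.map ((groupTrace T S H).restrictScalars T ∘ₗ LinearMap.mulLeft T c)
    ((groupTrace T S H).restrictScalars T)

theorem traceTensor_tmul_mul (c : S) (a b : FixedPoints.subalgebra T S H) (w : S ⊗[T] S) :
    traceTensor H c (((a : S) ⊗ₜ[T] (b : S)) * w) = (a ⊗ₜ[T] b) * traceTensor H c w := by
  have htrace (a : FixedPoints.subalgebra T S H) (s : S) :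
      groupTrace T S H (a * s) = a * groupTrace T S H s := (groupTrace T S H).map_smul a s
  induction w with
  | zero => simp
  | add x y hx hy => simp only [map_add, hx, hy, mul_add]
  | tmul x y => simp [traceTensor, mul_left_comm c, htrace]

theorem twistedMul_traceTensor (c : S) (g : G) (w : S ⊗[T] S) :
    twistedMul (FixedPoints.subalgebra T S H).val g (traceTensor H c w) =
      ∑ h : H, ∑ k : H, h • (c * twistedMul (AlgHom.id T S) ((h : G)⁻¹ * g * k) w) := by
  induction w with
  | zero => simp
  | add x y hx hy => simp only [map_add, hx, hy, mul_add, smul_add, Finset.sum_add_distrib]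
  | tmul a b =>
    simp only [traceTensor, TensorProduct.map_tmul, LinearMap.comp_apply, LinearMap.mulLeft_apply,
      LinearMap.restrictScalars_apply, Subalgebra.coe_val, twistedMul_tmul, coe_groupTrace,
      Finset.smul_sum, Finset.sum_mul_sum]
    refine Finset.sum_congr rfl fun h _ => Finset.sum_congr rfl fun k _ => ?_
    simp [smul_mul', Subgroup.smul_def, ← mul_smul, mul_assoc]

variable {H}

theorem Indicates.indicates_traceTensor {w : S ⊗[T] S}
    (hw : Indicates (AlgHom.id T S) (⊥ : Subgroup G) w) {c : S} (hc : groupTrace T S H c = 1) :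
    Indicates (FixedPoints.subalgebra T S H).val H (traceTensor H c w) := by
  classical
  have hcond (g : G) (h k : H) : (h : G)⁻¹ * g * k = 1 ↔ (k : G) = g⁻¹ * h := by
    rw [mul_assoc, inv_mul_eq_one, ← inv_mul_eq_iff_eq_mul, eq_comm]
  refine ⟨fun g hg => ?_, fun g hg => ?_⟩
  · have hsum (h : H) : ∑ k : H, h • (c * if (k : G) = g⁻¹ * h then 1 else 0) = h • c := by
      rw [Finset.sum_eq_single ⟨g⁻¹ * h, H.mul_mem (H.inv_mem hg) h.2⟩]
      · simp
      · exact fun k _ hk => by rw [if_neg (hk <| Subtype.ext ·), mul_zero, smul_zero]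
      · simp
    rw [twistedMul_traceTensor]
    simp_rw [hw.eq_ite, Subgroup.mem_bot, hcond, hsum]
    exact congrArg Subtype.val hc
  · rw [twistedMul_traceTensor]
    refine Finset.sum_eq_zero fun h _ => Finset.sum_eq_zero fun k _ => ?_
    rw [hw.eq_zero, mul_zero, smul_zero]
    rw [Subgroup.mem_bot, mul_assoc, inv_mul_eq_one, ← mul_inv_eq_iff_eq_mul]
    exact fun hk => hg (hk ▸ (h * k⁻¹).2)

end FixedPoints

theorem Indicates.exists_isSeparabilityIdempotent [Finite G] [Algebra.IsInvariant T S G]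
    {w : S ⊗[T] S} (hw : Indicates (AlgHom.id T S) (⊥ : Subgroup G) w) (H : Subgroup G) :
    ∃ e, IsSeparabilityIdempotent e ∧ Indicates (FixedPoints.subalgebra T S H).val H e := by
  have := Fintype.ofFinite H
  obtain ⟨c, hc⟩ := (hw.bot_of_subgroup H).exists_groupTrace_eq_one
  refine ⟨traceTensor H c w, ⟨Subtype.ext ?_, fun s => ?_⟩, hw.indicates_traceTensor hc⟩
  · rw [← Subalgebra.coe_val, ← twistedMul_eq_lmul' (fun _ => one_smul G _),
      (hw.indicates_traceTensor hc).eq_one 1 H.one_mem, map_one]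
  · rw [← traceTensor_tmul_mul, ← traceTensor_tmul_mul]
    exact congrArg _ (hw.isSeparabilityIdempotent.tmul_one_mul s)

theorem Indicates.fixingSubgroup_eq [Nontrivial S] {H : Subgroup G}
    {e : FixedPoints.subalgebra T S H ⊗[T] FixedPoints.subalgebra T S H}
    (he : Indicates (FixedPoints.subalgebra T S H).val H e) :
    fixingSubgroup G (FixedPoints.subalgebra T S H : Set S) = H := by
  ext g
  rw [mem_fixingSubgroup_iff]
  refine ⟨fun hg => ?_, fun hg s hs => hs ⟨g, hg⟩⟩
  have hlmul := twistedMul_eq_lmul' (j := (FixedPoints.subalgebra T S H).val)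
    (fun a => hg a a.2) e
  rw [← twistedMul_eq_lmul' (fun _ => one_smul G _) e, he.eq_one 1 H.one_mem] at hlmul
  by_contra hgH
  exact zero_ne_one ((he.eq_zero g hgH).symm.trans hlmul)

theorem IsSeparabilityIdempotent.indicates_fixingSubgroup
    (hS : ∀ s : S, IsIdempotentElem s → s = 0 ∨ s = 1) {L : Subalgebra T S} {e : L ⊗[T] L}
    (he : IsSeparabilityIdempotent e) : Indicates L.val (fixingSubgroup G (L : Set S)) e := by
  refine ⟨fun g hg => ?_, fun g hg => ?_⟩
  · rw [twistedMul_eq_lmul' fun a : L => (mem_fixingSubgroup_iff G).1 hg a a.2, he.lmul'_eq_one,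
      map_one]
  · refine (hS _ (he.isIdempotentElem.map _)).resolve_right fun hone => hg ?_
    refine (mem_fixingSubgroup_iff G).2 fun x hx => ?_
    simpa [hone] using (congrArg (twistedMul L.val g) (he.tmul_one_mul ⟨x, hx⟩)).symm

theorem Indicates.fixedPoints_le [Finite G] [Algebra.IsInvariant T S G] {H : Subgroup G}
    {w : S ⊗[T] S} (hw : Indicates (AlgHom.id T S) (⊥ : Subgroup G) w) {L : Subalgebra T S}
    {e : L ⊗[T] L} (he : Indicates L.val H e) : FixedPoints.subalgebra T S H ≤ L := fun s hs => by
  have := Fintype.ofFinite G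
  have := Fintype.ofFinite H
  obtain ⟨c, hc⟩ := (hw.bot_of_subgroup H).exists_groupTrace_eq_one
  obtain ⟨C, hC⟩ := TensorProduct.exists_finset e
  have hs' (h : H) : h • s = s := hs h
  have hc' : ∑ h : H, h • c = 1 := congrArg Subtype.val hc
  have key : ∑ p ∈ C, (p.1 : S) * ∑ g : G, g • ((p.2 : S) * (c * s)) = s := by
    refine (sum_mul_sum_smul_eq_sum_twistedMul (j := L.val) hC (c * s)).trans ?_
    simp_rw [he.sum_mul_smul, smul_mul', hs', ← Finset.sum_mul, hc', one_mul]
  rw [← key]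
  refine L.sum_mem fun p _ => L.mul_mem p.1.2 ?_
  obtain ⟨t, ht⟩ := exists_algebraMap_eq_sum_smul (T := T) (G := G) ((p.2 : S) * (c * s))
  exact ht ▸ L.algebraMap_mem t

variable [Finite G] [Algebra.IsInvariant T S G] [Nontrivial S]
  (hS : ∀ s : S, IsIdempotentElem s → s = 0 ∨ s = 1) {w : S ⊗[T] S}
  (hw : Indicates (AlgHom.id T S) (⊥ : Subgroup G) w)

include hw in
theorem Indicates.fixingSubgroup_fixedPoints (H : Subgroup G) :
    fixingSubgroup G (FixedPoints.subalgebra T S H : Set S) = H := by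
  obtain ⟨e, -, he⟩ := hw.exists_isSeparabilityIdempotent (T := T) H
  exact he.fixingSubgroup_eq

/-- The Galois correspondence between subgroups and separable subalgebras for a Galois extension
`S / T` of commutative rings in which `S` has no nontrivial idempotents. -/
def galoisCorrespondence : Subgroup G ≃o (SepSubalgebra T S)ᵒᵈ where
  toFun H := OrderDual.toDual ⟨FixedPoints.subalgebra T S H, by
    obtain ⟨e, he, -⟩ := hw.exists_isSeparabilityIdempotent H
    exact isSeparableAlgebra_iff_exists_isSeparabilityIdempotent.2 ⟨e, he⟩⟩
  invFun L := fixingSubgroup G ((OrderDual.ofDual L).1 : Set S)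
  left_inv := hw.fixingSubgroup_fixedPoints
  right_inv L := by
    obtain ⟨e, he⟩ :=
      isSeparableAlgebra_iff_exists_isSeparabilityIdempotent.1 (OrderDual.ofDual L).2
    refine congrArg OrderDual.toDual (Subtype.ext (le_antisymm ?_ fun s hs g => ?_))
    · exact hw.fixedPoints_le (he.indicates_fixingSubgroup hS)
    · exact (mem_fixingSubgroup_iff G).1 g.2 s hs
  map_rel_iff' {H K} := by
    refine ⟨fun h => ?_, fun h s hs k => hs ⟨k, h k.2⟩⟩
    rw [← hw.fixingSubgroup_fixedPoints H, ← hw.fixingSubgroup_fixedPoints K]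
    exact fixingSubgroup_antitone G S h

theorem galoisCorrespondence_bot : (OrderDual.ofDual (galoisCorrespondence hS hw ⊥)).1 = ⊤ :=
  eq_top_iff.2 fun s _ g => by rw [Subgroup.smul_def, Subgroup.mem_bot.1 g.2, one_smul]

theorem galoisCorrespondence_top : (OrderDual.ofDual (galoisCorrespondence hS hw ⊤)).1 = ⊥ :=
  eq_bot_iff.2 fun s hs =>
    Algebra.IsInvariant.isInvariant (G := G) s fun g => hs ⟨g, Subgroup.mem_top g⟩

end GaloisCorrespondence

/-! ### Separation of roots by `Δ` -/

section Delta

variable {n : ℕ}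

theorem cyc_pow_apply_of_lt {k j : Fin n} (h : j < k) (i : ℕ) : (cyc k ^ i) j = j := by
  have hfix : cyc k j = j := Fin.cycleIcc_of_lt h
  induction i with
  | zero => rfl
  | succ i ih => rw [pow_succ, Equiv.Perm.mul_apply, hfix, ih]

theorem val_cyc_pow_apply_self (k : Fin n) {i : ℕ} (hi : i < n - k) :
    ((cyc k ^ i) k : ℕ) = k + i := by
  have : NeZero n := ⟨by have := k.2; omega⟩
  induction i with
  | zero => simp
  | succ i ih =>
    have ih := ih (by omega)
    rw [pow_succ', Equiv.Perm.mul_apply, cyc, Fin.cycleIcc_of_ge_of_lt]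
    · change ((((cyc k ^ i) k) + 1 : Fin n) : ℕ) = _
      rw [Fin.val_add_one_of_lt', ih]
      · ring
      · omega
    · change k ≤ (cyc k ^ i) k
      rw [Fin.le_def, ih]
      omega
    · change (cyc k ^ i) k < _
      rw [Fin.lt_def, ih]
      change _ < n - 1
      omega

theorem exists_prod_drop_eq (π : Equiv.Perm (Fin n)) (m : ℕ) (hπ : ∀ j : Fin n, j < m → π j = j) :
    ∃ I : MultiIndex n, ((List.ofFn fun k => cyc k ^ (I k : ℕ)).drop m).prod = π := by
  by_cases hm : n ≤ m
  · refine ⟨fun k => ⟨0, by omega⟩, ?_⟩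
    rw [List.drop_eq_nil_of_le (by simpa using hm), List.prod_nil]
    exact (Equiv.ext fun j => hπ j (j.2.trans_le hm)).symm
  push Not at hm
  let k : Fin n := ⟨m, hm⟩
  have hk : k ≤ π k := by
    by_contra! hlt
    exact hlt.ne (π.injective (hπ _ hlt))
  let i : Fin (n - k) := ⟨π k - k, by have := (π k).2; omega⟩
  have hi : (cyc k ^ (i : ℕ)) k = π k := Fin.ext (by
    rw [val_cyc_pow_apply_self k i.2]
    exact Nat.add_sub_of_le hk)
  obtain ⟨I, hI⟩ := exists_prod_drop_eq ((cyc k ^ (i : ℕ))⁻¹ * π) (m + 1) fun j hj => by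
    rw [Equiv.Perm.mul_apply, Equiv.Perm.inv_eq_iff_eq]
    obtain hjm | hjm := Nat.lt_succ_iff_lt_or_eq.1 hj
    · rw [hπ j hjm, cyc_pow_apply_of_lt (by exact hjm)]
    · rw [show j = k from Fin.ext hjm, hi]
  refine ⟨Function.update I k i, ?_⟩
  have hdrop : (List.ofFn fun k' => cyc k' ^ (Function.update I k i k' : ℕ)).drop (m + 1) =
      (List.ofFn fun k' => cyc k' ^ (I k' : ℕ)).drop (m + 1) :=
    List.ext_getElem (by simp) fun a _ _ => by
      have hne : (⟨m + 1 + a, by grind⟩ : Fin n) ≠ k := Fin.ne_of_val_ne (by grind)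
      simp [Function.update_of_ne hne]
  rw [List.drop_eq_getElem_cons (by simpa using hm), List.prod_cons, hdrop, hI,
    List.getElem_ofFn, Function.update_self, mul_inv_cancel_left]
termination_by n - m

theorem sigmaPow_surjective : Function.Surjective (sigmaPow (n := n)) := fun π =>
  exists_prod_drop_eq π 0 (by simp)

theorem map_Delta {A A' : Type*} [CommRing A] [CommRing A'] (φ : A →+* A') (α : Fin n → A) :
    φ (Delta α) = Delta (φ ∘ α) := by
  rw [Delta, RingHom.map_det]
  congr 1
  ext I J
  simp [vMatrix]

variable {A : Type*} [CommRing A] {α : Fin n → A} {i j : Fin n}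

theorem Delta_eq_zero_of_eq (hij : i ≠ j) (h : α i = α j) : Delta α = 0 := by
  obtain ⟨I, hI⟩ := sigmaPow_surjective (1 : Equiv.Perm (Fin n))
  obtain ⟨I', hI'⟩ := sigmaPow_surjective (Equiv.swap i j)
  have hII' : I ≠ I' := by
    rintro rfl
    exact hij (Equiv.swap_eq_one_iff.1 (hI'.symm.trans hI))
  have hswap (k : Fin n) : α (Equiv.swap i j k) = α k := by
    rw [Equiv.swap_apply_def]
    split_ifs <;> simp_all
  refine Matrix.det_zero_of_row_eq hII' (funext fun J => ?_)
  simp only [vMatrix, Matrix.of_apply, hI, hI', Equiv.Perm.one_apply, hswap]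

theorem isUnit_sub_of_isUnit_Delta (h : IsUnit (Delta α)) (hij : i ≠ j) : IsUnit (α i - α j) := by
  by_contra hu
  obtain ⟨m, hm, hmem⟩ := exists_max_ideal_of_mem_nonunits hu
  have hzero : Ideal.Quotient.mk m (Delta α) = 0 := by
    rw [map_Delta]
    exact Delta_eq_zero_of_eq hij (Ideal.Quotient.eq.2 hmem)
  exact hm.ne_top (Ideal.eq_top_of_isUnit_mem _ (Ideal.Quotient.eq_zero_iff_mem.1 hzero) h)

end Delta

/-! ### Covering maps and quotients by groups -/

section Coverings

variable {X Y Z : Type*} [TopologicalSpace X] [TopologicalSpace Y] [TopologicalSpace Z]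

/-- The maps `t i : U → Y` are continuous sections of `f` over the open set `U` whose images are
open and partition `f ⁻¹' U`. Exhibiting sheets around every point is how maps are shown to be
coverings here. -/
structure IsSheets (f : Y → X) (U : Set X) {I : Type*} (t : I → U → Y) : Prop where
  isOpen : IsOpen U
  continuous (i : I) : Continuous (t i)
  apply_eq (i : I) (u : U) : f (t i u) = u
  isOpen_range (i : I) : IsOpen (Set.range (t i))
  existsUnique (y : Y) (hy : f y ∈ U) : ∃! i, t i ⟨f y, hy⟩ = y

namespace IsSheets

variable {f : Y → X} {U : Set X} {I : Type*} {t : I → U → Y}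

theorem eq_of_apply_eq (ht : IsSheets f U t) {i j : I} {u v : U} (h : t i u = t j v) : i = j := by
  have huv : u = v := Subtype.ext (by rw [← ht.apply_eq i u, h, ht.apply_eq])
  subst huv
  have hu : (⟨f (t i u), by simp [ht.apply_eq]⟩ : U) = u := Subtype.ext (ht.apply_eq i u)
  exact (ht.existsUnique (t i u) (by simp [ht.apply_eq])).unique (by rw [hu]) (by rw [hu, h])

theorem isEvenlyCovered (ht : IsSheets f U t) (hf : Continuous f) {x : X} (hx : x ∈ U) :
    IsEvenlyCovered f x (f ⁻¹' {x}) := by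
  let _ : TopologicalSpace I := ⊥
  have : DiscreteTopology I := ⟨rfl⟩
  let b (y : f ⁻¹' U) : U := ⟨f y, y.2⟩
  have hb : Continuous b := by fun_prop
  choose σ hσ using fun y : f ⁻¹' U => (ht.existsUnique y y.2).exists
  have hσ' {y : f ⁻¹' U} {i : I} {u : U} (h : t i u = y) : σ y = i :=
    ht.eq_of_apply_eq ((hσ y).trans h.symm)
  have hσcont : Continuous σ := by
    refine continuous_discrete_rng.2 fun i => ?_
    convert! (ht.isOpen_range i).preimage continuous_subtype_val using 1
    ext y
    exact ⟨fun h => ⟨_, h ▸ hσ y⟩, fun ⟨u, hu⟩ => hσ' hu⟩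
  have htU (p : U × I) : t p.2 p.1 ∈ f ⁻¹' U := by
    rw [Set.mem_preimage, ht.apply_eq]
    exact p.1.2
  let K : f ⁻¹' U ≃ₜ U × I :=
    { toFun := fun y => (b y, σ y)
      invFun := fun p => ⟨t p.2 p.1, htU p⟩
      left_inv := fun y => Subtype.ext (hσ y)
      right_inv := fun p => Prod.ext (Subtype.ext (ht.apply_eq p.2 p.1)) (hσ' rfl)
      continuous_toFun := hb.prodMk hσcont
      continuous_invFun := Continuous.subtype_mk
        (continuous_prod_of_discrete_right.2 fun i => ht.continuous i) _ }
  exact IsEvenlyCovered.to_isEvenlyCovered_preimage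
    ⟨inferInstance, U, hx, ht.isOpen, ht.isOpen.preimage hf, K, fun _ => rfl⟩

theorem restrict (ht : IsSheets f U t) (hf : Continuous f) {V : Set X} (hV : IsOpen V)
    (hVU : V ⊆ U) : IsSheets f V fun i => t i ∘ Set.inclusion hVU where
  isOpen := hV
  continuous i := (ht.continuous i).comp (continuous_inclusion hVU)
  apply_eq i u := ht.apply_eq i _
  isOpen_range i := by
    convert! (ht.isOpen_range i).inter (hV.preimage hf) using 1
    ext y
    constructor
    · rintro ⟨v, rfl⟩
      exact ⟨⟨_, rfl⟩, by simp [ht.apply_eq]⟩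
    · rintro ⟨⟨u, rfl⟩, hu⟩
      exact ⟨⟨u, by simpa [ht.apply_eq] using hu⟩, rfl⟩
  existsUnique y hy := ht.existsUnique y (hVU hy)

end IsSheets

theorem exists_isSheets {f : Y → X} (hf : IsCoveringMap f) (x : X) :
    ∃ U : Set X, x ∈ U ∧ ∃ t : f ⁻¹' {x} → U → Y, IsSheets f U t := by
  obtain ⟨_, U, hxU, hU, hU', H, hH⟩ := hf x
  have hK (y : Y) (hy : f y ∈ U) (i : f ⁻¹' {x}) :
      (H.symm (⟨f y, hy⟩, i) : Y) = y ↔ i = (H ⟨y, hy⟩).2 := by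
    have hfst : (H ⟨y, hy⟩).1 = ⟨f y, hy⟩ := Subtype.ext (hH ⟨y, hy⟩)
    rw [← hfst, ← Subtype.ext_iff (a2 := ⟨y, hy⟩), Homeomorph.symm_apply_eq, Prod.ext_iff]
    simp
  refine ⟨U, hxU, fun i u => H.symm (u, i), hU, fun i => by fun_prop, fun i u => ?_, fun i => ?_,
    fun y hy => ⟨_, (hK y hy _).2 rfl, fun i hi => (hK y hy i).1 hi⟩⟩
  · rw [← hH, H.apply_symm_apply]
  · have hopen : IsOpen (Set.univ ×ˢ {i} : Set (U × f ⁻¹' {x})) :=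
      isOpen_univ.prod (isOpen_discrete _)
    convert! hU'.isOpenMap_subtype_val _ (H.symm.isOpenMap _ hopen) using 1
    ext y
    constructor
    · rintro ⟨u, rfl⟩
      exact ⟨_, ⟨(u, i), ⟨trivial, rfl⟩, rfl⟩, rfl⟩
    · rintro ⟨_, ⟨⟨u, _⟩, ⟨-, rfl⟩, rfl⟩, rfl⟩
      exact ⟨u, rfl⟩

theorem isCoveringMap_restrict_of_isClopen [LocallyConnectedSpace X] {f : Y → X}
    (hf : IsCoveringMap f) {C : Set Y} (hC : IsClopen C) : IsCoveringMap fun y : C => f y := by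
  intro x
  obtain ⟨U, hxU, t, ht⟩ := exists_isSheets hf x
  obtain ⟨V, hVU, hV, hxV, hVc⟩ :=
    locallyConnectedSpace_iff_subsets_isOpen_isConnected.1 ‹_› x U (ht.isOpen.mem_nhds hxU)
  have ht := ht.restrict hf.continuous hV hVU
  set t := fun i => t i ∘ Set.inclusion hVU
  have := isPreconnected_iff_preconnectedSpace.1 hVc.isPreconnected
  have hmem {i : f ⁻¹' {x}} {v : V} (h : t i v ∈ C) (w : V) : t i w ∈ C :=
    ((hC.preimage (ht.continuous i)).eq_univ ⟨v, h⟩).ge (Set.mem_univ w)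
  have hsheets : IsSheets (fun y : C => f y) V
      fun (i : {i // ∃ v, t i v ∈ C}) v => ⟨t i v, hmem i.2.choose_spec v⟩ :=
    { isOpen := hV
      continuous := fun i => Continuous.subtype_mk (ht.continuous i) _
      apply_eq := fun i v => ht.apply_eq i v
      isOpen_range := fun i => by
        convert! (ht.isOpen_range i).preimage continuous_subtype_val using 1
        ext y
        simp [Subtype.ext_iff]
      existsUnique := fun y hy => by
        obtain ⟨i, hi, huniq⟩ := ht.existsUnique y hy
        exact ⟨⟨i, _, hi ▸ y.2⟩, Subtype.ext hi, fun j hj =>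
          Subtype.ext (huniq j (congrArg Subtype.val hj))⟩ }
  exact hsheets.isEvenlyCovered (hf.continuous.comp continuous_subtype_val) hxV

theorem surjective_of_isCoveringMap_comp [PathConnectedSpace Z] [Nonempty Y] {r : Z → X}
    {s : Y → Z} (hr : IsCoveringMap r) (hs : Continuous s) (hrs : IsCoveringMap (r ∘ s)) :
    Function.Surjective s := by
  intro z
  obtain ⟨y⟩ := ‹Nonempty Y›
  let γ := PathConnectedSpace.somePath (s y) z
  let γ' : C(unitInterval, X) := ⟨r ∘ γ, hr.continuous.comp γ.continuous⟩
  have h0 : γ' 0 = (r ∘ s) y := congrArg r γ.source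
  let δ := hrs.liftPath γ' y h0
  have hδ : s ∘ δ = γ := hr.eq_of_comp_eq (hs.comp δ.continuous) γ.continuous
    (hrs.liftPath_lifts γ' y h0) 0 (by simp [δ, hrs.liftPath_zero])
  exact ⟨δ 1, by simpa using congrFun hδ 1⟩

theorem surjective_of_isCoveringMap [PathConnectedSpace X] [Nonempty Y] {f : Y → X}
    (hf : IsCoveringMap f) : Function.Surjective f :=
  surjective_of_isCoveringMap_comp (isCoveringMap_id X) hf.continuous hf

theorem locallyPathConnectedSpace_of_isLocalHomeomorph [LocallyPathConnectedSpace X] {f : Y → X}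
    (hf : IsLocalHomeomorph f) : LocallyPathConnectedSpace Y := by
  choose φ hφ _ using hf
  let _ : ChartedSpace X Y :=
    { atlas := Set.range φ
      chartAt := φ
      mem_chart_source := hφ
      chart_mem_atlas := Set.mem_range_self }
  exact ChartedSpace.locallyPathConnectedSpace X Y

end Coverings

section QuotientCoverings

variable {E X Y G : Type*} [TopologicalSpace E] [TopologicalSpace X] [Group G]
  [MulAction G E] {H : Subgroup G} {p : E → X} {k : E → Y} {r : Y → X}

theorem card_fiber_eq_index (hp : IsQuotientCoveringMap p G) (hk : Function.Surjective k)
    (hH : ∀ g : G, ∀ e, k (g • e) = k e ↔ g ∈ H) (hr : r ∘ k = p) (x : X) :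
    Nat.card (r ⁻¹' {x}) = H.index := by
  obtain ⟨e, rfl⟩ := hp.surjective x
  have hrk (e : E) : r (k e) = p e := congrFun hr e
  let φ (g : G) : r ⁻¹' {p e} := ⟨k (g • e), (hrk _).trans (hp.map_smul g)⟩
  have hφ : Function.Surjective φ := by
    rintro ⟨y, hy⟩
    obtain ⟨e', rfl⟩ := hk y
    obtain ⟨g, rfl⟩ := hp.apply_eq_iff_mem_orbit.1 ((hrk e').symm.trans hy)
    exact ⟨g, rfl⟩
  have hker : Setoid.ker φ = QuotientGroup.rightRel H := by
    ext g g'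
    rw [Setoid.ker_def, QuotientGroup.rightRel_apply, ← hH _ (g • e), mul_smul, inv_smul_smul,
      Subtype.ext_iff, eq_comm]
  calc Nat.card (r ⁻¹' {p e}) = Nat.card (Quotient (Setoid.ker φ)) :=
        (Nat.card_congr (Setoid.quotientKerEquivOfSurjective φ hφ)).symm
    _ = Nat.card (G ⧸ H) := by
        rw [hker]
        exact Nat.card_congr (QuotientGroup.quotientRightRelEquivQuotientLeftRel H)

variable [TopologicalSpace Y]

theorem isQuotientCoveringMap_subgroup (hp : IsQuotientCoveringMap p G) (hk : IsQuotientMap k)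
    (hH : ∀ {e e'}, k e = k e' ↔ e ∈ MulAction.orbit H e') : IsQuotientCoveringMap k H where
  __ := hk
  continuous_const_smul g := hp.continuous_const_smul (g : G)
  apply_eq_iff_mem_orbit := hH
  disjoint e := by
    obtain ⟨U, hU, hU'⟩ := hp.disjoint e
    exact ⟨U, hU, fun g hg => Subtype.ext (hU' g hg)⟩

theorem isCoveringMap_of_comp_eq (hp : IsQuotientCoveringMap p G) (hk : IsOpenQuotientMap k)
    (hH : ∀ g : G, ∀ e, k (g • e) = k e ↔ g ∈ H) (hr : r ∘ k = p) : IsCoveringMap r := by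
  intro x
  obtain ⟨e, rfl⟩ := hp.surjective x
  obtain ⟨U, hxU, t, ht⟩ := exists_isSheets hp.isCoveringMap (p e)
  have hrk (e : E) : r (k e) = p e := congrFun hr e
  let s := t ⟨e, rfl⟩
  let I := Set.range fun (g : G) (e : E) => k (g • e)
  have hsheets : IsSheets r U fun (i : I) u => i.1 (s u) :=
    { isOpen := ht.isOpen
      continuous := by
        rintro ⟨_, g, rfl⟩
        exact hk.continuous.comp ((hp.continuous_const_smul g).comp (ht.continuous _))
      apply_eq := by
        rintro ⟨_, g, rfl⟩ u
        exact (hrk _).trans ((hp.map_smul g).trans (ht.apply_eq _ u))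
      isOpen_range := by
        rintro ⟨_, g, rfl⟩
        have := hp.toContinuousConstSMul
        have hopen := hk.isOpenMap _ (isOpenMap_smul g _ (ht.isOpen_range ⟨e, rfl⟩))
        rwa [← Set.range_comp, ← Set.range_comp] at hopen
      existsUnique := by
        intro y hy
        obtain ⟨e', rfl⟩ := hk.surjective y
        obtain ⟨g, hg⟩ := hp.apply_eq_iff_mem_orbit.1
          ((hrk e').symm.trans (ht.apply_eq ⟨e, rfl⟩ ⟨_, hy⟩).symm)
        refine ⟨⟨_, g, rfl⟩, congrArg k hg, ?_⟩
        rintro ⟨_, g', rfl⟩ hg'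
        have hg : e' = g • s ⟨r (k e'), hy⟩ := hg.symm
        have hmem : g' * g⁻¹ ∈ H := (hH _ e').1 <| by
          calc k ((g' * g⁻¹) • e') = k (g' • g⁻¹ • e') := by rw [mul_smul]
            _ = k (g' • s ⟨r (k e'), hy⟩) := by rw [← eq_inv_smul_iff.2 hg.symm]
            _ = k e' := hg'
        refine Subtype.ext (funext fun e => ?_)
        have := (hH _ (g • e)).2 hmem
        rwa [mul_smul, inv_smul_smul] at this }
  exact hsheets.isEvenlyCovered (hk.isQuotientMap.continuous_iff.2 (hr ▸ hp.continuous)) hxU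

end QuotientCoverings

/-! ### Orderings of the roots of a Weierstrass polynomial -/

section Roots

variable {X Y : Type*} [TopologicalSpace X] [TopologicalSpace Y]

theorem eval_fiberPoly_apply (f : C(X, ℂ)[X]) (β : C(X, ℂ)) (x : X) :
    (fiberPoly f x).eval (β x) = (f.eval β) x := by
  rw [fiberPoly, eval_map]
  exact eval₂_hom (ContinuousMap.evalAlgHom ℂ ℂ x : C(X, ℂ) →ₐ[ℂ] ℂ).toRingHom β

theorem isFunRoot_iff {f : C(X, ℂ)[X]} {β : C(X, ℂ)} : IsFunRoot f β ↔ f.eval β = 0 := by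
  simp_rw [IsFunRoot, eval_fiberPoly_apply, ContinuousMap.ext_iff, ContinuousMap.zero_apply]

@[simp]
theorem fiberPoly_map_pullback (q : C(Y, X)) (f : C(X, ℂ)[X]) (y : Y) :
    fiberPoly (f.map (pullback q)) y = fiberPoly f (q y) := by
  rw [fiberPoly, fiberPoly, Polynomial.map_map]
  rfl

theorem fiberPoly_derivative (f : C(X, ℂ)[X]) (x : X) :
    fiberPoly (derivative f) x = derivative (fiberPoly f x) :=
  (derivative_map f _).symm

theorem isFunRoot_map_iff {q : C(Y, X)} {f : C(X, ℂ)[X]} {β : C(Y, ℂ)} :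
    IsFunRoot (f.map (pullback q)) β ↔ ∀ y, (fiberPoly f (q y)).eval (β y) = 0 := by
  simp [IsFunRoot]

namespace IsWeierstrass

variable {f : C(X, ℂ)[X]} {n : ℕ}

theorem fiberPoly_ne_zero (hf : IsWeierstrass f n) (x : X) : fiberPoly f x ≠ 0 :=
  (hf.monic.map _).ne_zero

theorem setOf_eval_eq_zero (hf : IsWeierstrass f n) (x : X) :
    {z : ℂ | (fiberPoly f x).eval z = 0} = (fiberPoly f x).roots.toFinset := by
  ext z
  simp [hf.fiberPoly_ne_zero x]

theorem finite_roots (hf : IsWeierstrass f n) (x : X) :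
    {z : ℂ | (fiberPoly f x).eval z = 0}.Finite := by
  rw [hf.setOf_eval_eq_zero]
  exact Finset.finite_toSet _

theorem nodup_roots (hf : IsWeierstrass f n) (x : X) : (fiberPoly f x).roots.Nodup := by
  have hcard := hf.ncard_roots x
  rw [hf.setOf_eval_eq_zero, Set.ncard_coe_finset] at hcard
  have hdeg : (fiberPoly f x).natDegree = n := by
    rw [fiberPoly, hf.monic.natDegree_map, hf.natDegree_eq]
  rw [← Multiset.toFinset_card_eq_card_iff_nodup]
  exact le_antisymm (Multiset.toFinset_card_le _) (hcard ▸ hdeg ▸ card_roots' _)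

theorem eval_derivative_ne_zero (hf : IsWeierstrass f n) {x : X} {z : ℂ}
    (hz : (fiberPoly f x).eval z = 0) : (fiberPoly (derivative f) x).eval z ≠ 0 := by
  intro hd
  rw [fiberPoly_derivative] at hd
  refine ((one_lt_rootMultiplicity_iff_isRoot (hf.fiberPoly_ne_zero x)).2 ⟨hz, hd⟩).not_ge ?_
  rw [← count_roots]
  exact Multiset.nodup_iff_count_le_one.1 (hf.nodup_roots x) z

theorem eq_of_apply_eq [PreconnectedSpace Y] (hf : IsWeierstrass f n) {q : C(Y, X)}
    {β γ : C(Y, ℂ)} (hβ : IsFunRoot (f.map (pullback q)) β)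
    (hγ : IsFunRoot (f.map (pullback q)) γ) {y : Y} (hy : β y = γ y) : β = γ := by
  set F := f.map (pullback q) with hF
  -- Taylor expansion at `β` gives `0 = F γ = h * (γ - β)` with `h = F' β` wherever `γ = β`.
  obtain ⟨k, hk⟩ := F.binomExpansion β (γ - β)
  rw [add_sub_cancel, isFunRoot_iff.1 hγ, isFunRoot_iff.1 hβ] at hk
  let h : C(Y, ℂ) := F.derivative.eval β + k * (γ - β)
  have hprod (y : Y) : h y * (γ y - β y) = 0 := by
    have hmul : h * (γ - β) = 0 := by
      simp only [h]
      linear_combination -hk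
    exact DFunLike.congr_fun hmul y
  have hne {y : Y} (hy : β y = γ y) : h y ≠ 0 := by
    have hderiv : h y = (F.derivative.eval β) y := by simp [h, hy]
    rw [hderiv, ← eval_fiberPoly_apply, hF, derivative_map, fiberPoly_map_pullback]
    exact hf.eval_derivative_ne_zero (isFunRoot_map_iff.1 hβ y)
  have hclosed : IsClosed {y | β y = γ y} := isClosed_eq β.continuous γ.continuous
  have hopen : IsOpen {y | β y = γ y} := by
    refine isOpen_iff_mem_nhds.2 fun y hy => ?_
    filter_upwards [h.continuous.continuousAt.eventually_ne (hne hy)] with y' hy'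
    exact (sub_eq_zero.1 ((mul_eq_zero.1 (hprod y')).resolve_left hy')).symm
  exact ContinuousMap.ext fun y => (IsClopen.eq_univ ⟨hclosed, hopen⟩ ⟨_, hy⟩).ge trivial

end IsWeierstrass

namespace IsRootList

variable {f : C(X, ℂ)[X]} {n : ℕ} {q : C(Y, X)} {α : Fin n → C(Y, ℂ)}

theorem eval_eq_zero (hα : IsRootList q f α) (i : Fin n) (y : Y) :
    (fiberPoly f (q y)).eval (α i y) = 0 :=
  isFunRoot_map_iff.1 (hα.isFunRoot i) y

theorem comp_perm (hα : IsRootList q f α) (σ : Equiv.Perm (Fin n)) : IsRootList q f (α ∘ σ) :=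
  ⟨hα.injective.comp σ.injective, fun i => hα.isFunRoot (σ i)⟩

variable [PreconnectedSpace Y]

theorem injective_apply (hf : IsWeierstrass f n) (hα : IsRootList q f α) (y : Y) :
    Function.Injective fun i => α i y := fun i j hij =>
  hα.injective (hf.eq_of_apply_eq (hα.isFunRoot i) (hα.isFunRoot j) hij)

theorem exists_apply_eq (hf : IsWeierstrass f n) (hα : IsRootList q f α) {y : Y} {z : ℂ}
    (hz : (fiberPoly f (q y)).eval z = 0) : ∃ i, α i y = z := by
  have hsub : Set.range (fun i => α i y) ⊆ {z : ℂ | (fiberPoly f (q y)).eval z = 0} := by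
    rintro _ ⟨i, rfl⟩
    exact hα.eval_eq_zero i y
  have hcard : (Set.range fun i => α i y).ncard = n := by
    rw [← Set.image_univ, Set.ncard_image_of_injective _ (hα.injective_apply hf y),
      Set.ncard_univ, Nat.card_eq_fintype_card, Fintype.card_fin]
  exact (Set.eq_of_subset_of_ncard_le hsub (by rw [hf.ncard_roots, hcard])
    (hf.finite_roots (q y))).ge hz

theorem exists_eq (hf : IsWeierstrass f n) (hα : IsRootList q f α) [Nonempty Y] {β : C(Y, ℂ)}
    (hβ : IsFunRoot (f.map (pullback q)) β) : ∃ i, α i = β := by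
  obtain ⟨y⟩ := ‹Nonempty Y›
  obtain ⟨i, hi⟩ := hα.exists_apply_eq hf (isFunRoot_map_iff.1 hβ y)
  exact ⟨i, hf.eq_of_apply_eq (hα.isFunRoot i) hβ hi⟩

theorem exists_perm (hf : IsWeierstrass f n) (hα : IsRootList q f α) {y : Y} {z : Fin n → ℂ}
    (hz : Function.Injective z) (hz' : ∀ i, (fiberPoly f (q y)).eval (z i) = 0) :
    ∃ σ : Equiv.Perm (Fin n), ∀ i, α (σ i) y = z i := by
  choose σ hσ using fun i => hα.exists_apply_eq hf (hz' i)
  have hinj : Function.Injective σ := fun i j hij => hz (by rw [← hσ, ← hσ, hij])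
  exact ⟨Equiv.ofBijective σ (Finite.injective_iff_bijective.1 hinj), hσ⟩

end IsRootList

end Roots

section RootOrderings

variable {X E : Type*} [TopologicalSpace X] [TopologicalSpace E]

/-- The space of pairs of a point `x` and an ordering of the `n` roots of `f_x`, topologized as a
subspace of `X × ℂⁿ`. It is the universal place where `f` splits, but need not be connected. -/
def RootOrderings (f : C(X, ℂ)[X]) (n : ℕ) : Type _ :=
  {p : X × (Fin n → ℂ) // Function.Injective p.2 ∧ ∀ i, (fiberPoly f p.1).eval (p.2 i) = 0}

namespace RootOrderings

variable {f : C(X, ℂ)[X]} {n : ℕ} {q : C(E, X)} {α : Fin n → C(E, ℂ)}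

instance : TopologicalSpace (RootOrderings f n) := instTopologicalSpaceSubtype

/-- The projection `(x, z) ↦ x` of the space of orderings of the roots. -/
def proj (f : C(X, ℂ)[X]) (n : ℕ) : C(RootOrderings f n, X) :=
  ⟨fun p => p.1.1, continuous_fst.comp continuous_subtype_val⟩

/-- The tautological root `(x, z) ↦ z i` on the space of orderings of the roots. -/
def root (f : C(X, ℂ)[X]) (n : ℕ) (i : Fin n) : C(RootOrderings f n, ℂ) :=
  ⟨fun p => p.1.2 i, (continuous_apply i).comp (continuous_snd.comp continuous_subtype_val)⟩

theorem ext {p p' : RootOrderings f n} (h : proj f n p = proj f n p')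
    (h' : ∀ i, root f n i p = root f n i p') : p = p' :=
  Subtype.ext (Prod.ext h (funext h'))

theorem root_injective (p : RootOrderings f n) : Function.Injective fun i => root f n i p := p.2.1

theorem eval_root (p : RootOrderings f n) (i : Fin n) :
    (fiberPoly f (proj f n p)).eval (root f n i p) = 0 := p.2.2 i

theorem finite_fiber (hf : IsWeierstrass f n) (x : X) : (proj f n ⁻¹' {x}).Finite := by
  have hfin : (Set.univ.pi fun _ : Fin n => {z : ℂ | (fiberPoly f x).eval z = 0}).Finite :=
    Set.Finite.pi fun _ => hf.finite_roots x
  refine Set.Finite.of_finite_image (f := fun p i => root f n i p) (hfin.subset ?_) ?_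
  · rintro _ ⟨p, rfl, rfl⟩ i -
    exact eval_root p i
  · intro p hp p' hp' h
    exact ext (hp.trans hp'.symm) fun i => congrFun h i

variable [PreconnectedSpace E]

/-- The classifying map `y ↦ (q y, α y)` of a list `α` of roots of `q* f`. -/
def ofRoots (hf : IsWeierstrass f n) (hα : IsRootList q f α) : C(E, RootOrderings f n) :=
  ⟨fun y => ⟨(q y, fun i => α i y), hα.injective_apply hf y, fun i => hα.eval_eq_zero i y⟩,
    Continuous.subtype_mk (by fun_prop) _⟩

@[simp]
theorem proj_ofRoots (hf : IsWeierstrass f n) (hα : IsRootList q f α) (y : E) :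
    proj f n (ofRoots hf hα y) = q y := rfl

theorem exists_perm_ofRoots_eq (hf : IsWeierstrass f n) (hα : IsRootList q f α) {y : E}
    {p : RootOrderings f n} (h : q y = proj f n p) :
    ∃ σ : Equiv.Perm (Fin n), ofRoots hf (hα.comp_perm σ) y = p := by
  obtain ⟨σ, hσ⟩ := hα.exists_perm hf (root_injective p) fun i => by rw [h]; exact eval_root p i
  exact ⟨σ, ext h hσ⟩

theorem ofRoots_comp_perm_injective (hf : IsWeierstrass f n) (hα : IsRootList q f α) (y : E) :
    Function.Injective fun σ : Equiv.Perm (Fin n) => ofRoots hf (hα.comp_perm σ) y :=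
  fun _ _ h => Equiv.ext fun i => hα.injective_apply hf y (congrArg (root f n i) h)

/-- The image is cut out by the open conditions `α j ≠ z i` for `j ≠ σ i`. -/
theorem isOpen_range_ofRoots_comp (hf : IsWeierstrass f n) (hα : IsRootList q f α) {U : Set X}
    (hU : IsOpen U) {s : U → E} (hs : Continuous s) (hqs : ∀ u, q (s u) = u)
    (σ : Equiv.Perm (Fin n)) : IsOpen (Set.range (ofRoots hf (hα.comp_perm σ) ∘ s)) := by
  let V := proj f n ⁻¹' U
  have hV : IsOpen V := hU.preimage (proj f n).continuous
  let b (p : V) : U := ⟨proj f n p.1, p.2⟩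
  have hb : Continuous b := by fun_prop
  have hopen : IsOpen {p : V | ∀ i j, j ≠ σ i → α j (s (b p)) ≠ root f n i p.1} := by
    simp only [Set.ofPred_forall]
    exact isOpen_iInter_of_finite fun i => isOpen_iInter_of_finite fun j =>
      isOpen_iInter_of_finite fun _ => isOpen_ne_fun (by fun_prop) (by fun_prop)
  convert! hV.isOpenMap_subtype_val _ hopen using 1
  ext p
  constructor
  · rintro ⟨u, rfl⟩
    have hbu (h : ofRoots hf (hα.comp_perm σ) (s u) ∈ V) : b ⟨_, h⟩ = u := Subtype.ext (hqs u)
    refine ⟨⟨_, by simp [V, hqs]⟩, fun i j hj => ?_, rfl⟩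
    rw [hbu]
    exact (hα.injective_apply hf (s u)).ne hj
  · rintro ⟨p, hp, rfl⟩
    obtain ⟨τ, hτ⟩ := exists_perm_ofRoots_eq hf hα (hqs (b p))
    have hτσ : τ = σ := Equiv.ext fun i => by
      by_contra hne
      exact hp i (τ i) hne (congrArg (root f n i) hτ)
    exact ⟨b p, hτσ ▸ hτ⟩

theorem isCoveringMap_proj (hf : IsWeierstrass f n) (hα : IsRootList q f α)
    (hq : IsCoveringMap q) (hsurj : Function.Surjective q) : IsCoveringMap (proj f n) := by
  intro x
  obtain ⟨e, rfl⟩ := hsurj x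
  obtain ⟨U, hxU, t, ht⟩ := exists_isSheets hq (q e)
  let s := t ⟨e, rfl⟩
  have hs : Continuous s := ht.continuous _
  have hqs : ∀ u, q (s u) = u := ht.apply_eq _
  have hsheets : IsSheets (proj f n) U
      fun (σ : Equiv.Perm (Fin n)) u => ofRoots hf (hα.comp_perm σ) (s u) :=
    { isOpen := ht.isOpen
      continuous := fun σ => by fun_prop
      apply_eq := fun _ => hqs
      isOpen_range := isOpen_range_ofRoots_comp hf hα ht.isOpen hs hqs
      existsUnique := fun p hp => by
        obtain ⟨σ, hσ⟩ := exists_perm_ofRoots_eq hf hα (hqs ⟨_, hp⟩)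
        exact ⟨σ, hσ, fun τ hτ => ofRoots_comp_perm_injective hf hα _ (hτ.trans hσ.symm)⟩ }
  exact hsheets.isEvenlyCovered (proj f n).continuous hxU

end RootOrderings

end RootOrderings

/-! ### Splitting coverings are quotients by their covering transformations -/

section Deck

variable {X E : Type*} [TopologicalSpace X] [TopologicalSpace E] {q : C(E, X)}

instance homeomorphMulAction : MulAction (E ≃ₜ E) E where
  smul Φ y := Φ y
  one_smul _ := rfl
  mul_smul _ _ _ := rfl

theorem deck_smul_def (Φ : deck q) (y : E) : Φ • y = (Φ : E ≃ₜ E) y := rfl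

theorem map_deck_smul (Φ : deck q) (y : E) : q (Φ • y) = q y := Φ.2 y

instance continuousConstSMul_deck : ContinuousConstSMul (deck q) E :=
  ⟨fun Φ => (Φ : E ≃ₜ E).continuous⟩

theorem deck_ext [PreconnectedSpace E] (hq : IsCoveringMap q) {Φ Ψ : deck q} {e : E}
    (h : Φ • e = Ψ • e) : Φ = Ψ := by
  refine Subtype.ext (Homeomorph.ext fun y => ?_)
  exact congrFun (hq.eq_of_comp_eq (continuous_const_smul Φ) (continuous_const_smul Ψ)
    (funext fun y => (map_deck_smul Φ y).trans (map_deck_smul Ψ y).symm) e h) y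

theorem isQuotientCoveringMap_deck [PreconnectedSpace E] (hq : IsCoveringMap q)
    (hsurj : Function.Surjective q)
    (htrans : ∀ {e e'}, q e = q e' → ∃ Φ : deck q, Φ • e' = e) :
    IsQuotientCoveringMap q (deck q) :=
  (isQuotientCoveringMap_iff_isCoveringMap_and _ _).2 ⟨hq, hsurj, inferInstance,
    ⟨fun _ _ _ h => deck_ext hq h⟩, htrans, fun ⟨Φ, hΦ⟩ => hΦ ▸ map_deck_smul Φ _⟩

end Deck

section Splitting

namespace RootOrderings

variable {X E : Type*} [TopologicalSpace X] [TopologicalSpace E] {f : C(X, ℂ)[X]} {n : ℕ}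
  {q : C(E, X)} {α : Fin n → C(E, ℂ)}

/-- The restriction of `proj f n` to the connected component of `c`. -/
def componentProj (c : RootOrderings f n) : C(connectedComponent c, X) :=
  (proj f n).restrict _

theorem splitsIn_componentProj (c : RootOrderings f n) : SplitsIn (componentProj c) f n :=
  ⟨fun i => (root f n i).restrict _,
    fun _ _ h => root_injective c (DFunLike.congr_fun h ⟨c, mem_connectedComponent⟩),
    fun i => isFunRoot_map_iff.2 fun p => eval_root p.1 i⟩

variable [PreconnectedSpace E]

/-- The classifying map of a list of roots, with values in a component that it meets. -/
def toComponent (hf : IsWeierstrass f n) (hα : IsRootList q f α) (e₀ : E) :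
    C(E, connectedComponent (ofRoots hf hα e₀)) :=
  ⟨fun e => ⟨ofRoots hf hα e, (isPreconnected_range (ofRoots hf hα).continuous)
    |>.subset_connectedComponent ⟨e₀, rfl⟩ ⟨e, rfl⟩⟩, by fun_prop⟩

section Component

variable [LocallyPathConnectedSpace X] (hf : IsWeierstrass f n) (hα : IsRootList q f α)
  (hq : IsCoveringMap q) (hsurj : Function.Surjective q) (c : RootOrderings f n)

include hf hα hq hsurj

theorem locallyPathConnectedSpace : LocallyPathConnectedSpace (RootOrderings f n) :=
  locallyPathConnectedSpace_of_isLocalHomeomorph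
    (isCoveringMap_proj hf hα hq hsurj).isLocalHomeomorph

theorem pathConnectedSpace_component : PathConnectedSpace (connectedComponent c) := by
  have := locallyPathConnectedSpace hf hα hq hsurj
  rw [← pathComponent_eq_connectedComponent]
  exact isPathConnected_iff_pathConnectedSpace.1 isPathConnected_pathComponent

theorem isCoveringMap_componentProj : IsCoveringMap (componentProj c) := by
  have := locallyPathConnectedSpace hf hα hq hsurj
  exact isCoveringMap_restrict_of_isClopen (isCoveringMap_proj hf hα hq hsurj)
    isClopen_connectedComponent

theorem isLocalHomeomorph_toComponent (e₀ : E) :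
    IsLocalHomeomorph (toComponent hf hα e₀) := by
  have hcomp : IsLocalHomeomorph (componentProj (ofRoots hf hα e₀) ∘ toComponent hf hα e₀) :=
    hq.isLocalHomeomorph
  exact hcomp.of_comp (isCoveringMap_componentProj hf hα hq hsurj _).isLocalHomeomorph
    (toComponent hf hα e₀).continuous

theorem surjective_toComponent (e₀ : E) : Function.Surjective (toComponent hf hα e₀) := by
  have := pathConnectedSpace_component hf hα hq hsurj (ofRoots hf hα e₀)
  have : Nonempty E := ⟨e₀⟩
  exact surjective_of_isCoveringMap_comp (isCoveringMap_componentProj hf hα hq hsurj _)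
    (toComponent hf hα e₀).continuous hq

end Component

end RootOrderings

namespace IsSplittingCovering

open RootOrderings

variable {X E : Type u} [TopologicalSpace X] [TopologicalSpace E] [PathConnectedSpace X]
  {f : C(X, ℂ)[X]} {n : ℕ} {q : C(E, X)} {α : Fin n → C(E, ℂ)}

theorem surjective (hq : IsSplittingCovering q f n) : Function.Surjective q := by
  have := hq.pathConnected
  exact surjective_of_isCoveringMap hq.isCoveringMap

variable [LocallyPathConnectedSpace X]

theorem exists_surjective_component (hf : IsWeierstrass f n) (hq : IsSplittingCovering q f n)
    (c : RootOrderings f n) :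
    ∃ π : C(connectedComponent c, E), Function.Surjective π ∧ q.comp π = componentProj c := by
  have := hq.pathConnected
  obtain ⟨α, hα⟩ := hq.splits
  have := pathConnectedSpace_component hf hα hq.isCoveringMap hq.surjective c
  have hp := isCoveringMap_componentProj hf hα hq.isCoveringMap hq.surjective c
  obtain ⟨π, hπ, hqπ⟩ := hq.minimal _ _ hp (splitsIn_componentProj c)
  exact ⟨π, surjective_of_isCoveringMap hπ, hqπ⟩

theorem finite_fiber (hf : IsWeierstrass f n) (hq : IsSplittingCovering q f n) (x : X) :
    (q ⁻¹' {x}).Finite := by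
  have := hq.pathConnected
  obtain ⟨α, hα⟩ := hq.splits
  obtain ⟨e⟩ := (inferInstance : Nonempty E)
  obtain ⟨π, hπ, hqπ⟩ := hq.exists_surjective_component hf (ofRoots hf hα e)
  refine (((RootOrderings.finite_fiber hf x).preimage
    Subtype.val_injective.injOn).image π).subset fun e he => ?_
  obtain ⟨c, rfl⟩ := hπ e
  exact ⟨c, (DFunLike.congr_fun hqπ c).symm.trans he, rfl⟩

/-- By minimality, some `π ∘ toComponent` is a surjection of each finite fibre onto itself. -/
theorem injective_toComponent [PreconnectedSpace E] (hf : IsWeierstrass f n)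
    (hq : IsSplittingCovering q f n) (hα : IsRootList q f α) (e₀ : E) :
    Function.Injective (toComponent hf hα e₀) := by
  intro e e' h
  obtain ⟨π, hπ, hqπ⟩ := hq.exists_surjective_component hf (ofRoots hf hα e₀)
  have hqρ (y : E) : q (π (toComponent hf hα e₀ y)) = q y := DFunLike.congr_fun hqπ _
  have hqe : q e = q e' := congrArg (componentProj _) h
  have : Finite (q ⁻¹' {q e'}) := hq.finite_fiber hf (q e')
  let g (y : q ⁻¹' {q e'}) : q ⁻¹' {q e'} := ⟨π (toComponent hf hα e₀ y), (hqρ y).trans y.2⟩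
  have hg : Function.Surjective g := by
    rintro ⟨y, hy⟩
    obtain ⟨y, rfl⟩ := (hπ.comp
      (surjective_toComponent hf hα hq.isCoveringMap hq.surjective e₀)) y
    exact ⟨⟨y, (hqρ y).symm.trans hy⟩, rfl⟩
  exact congrArg Subtype.val (Finite.injective_iff_surjective.2 hg (a₁ := ⟨e, hqe⟩)
    (a₂ := ⟨e', rfl⟩) (Subtype.ext (congrArg π h)))

theorem eq_of_roots_eq (hf : IsWeierstrass f n) (hq : IsSplittingCovering q f n)
    (hα : IsRootList q f α) {e e' : E} (h : q e = q e') (h' : ∀ i, α i e = α i e') : e = e' := by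
  have := hq.pathConnected
  exact hq.injective_toComponent hf hα e (Subtype.ext (RootOrderings.ext h h'))

theorem exists_homeomorph_component [PreconnectedSpace E] (hf : IsWeierstrass f n)
    (hq : IsSplittingCovering q f n) (hα : IsRootList q f α) {e₀ : E} {c : RootOrderings f n}
    (hc : ofRoots hf hα e₀ = c) :
    ∃ Ψ : E ≃ₜ connectedComponent c, ∀ e, (Ψ e : RootOrderings f n) = ofRoots hf hα e := by
  subst hc
  have hbij : Function.Bijective (toComponent hf hα e₀) :=
    ⟨hq.injective_toComponent hf hα e₀,
      surjective_toComponent hf hα hq.isCoveringMap hq.surjective e₀⟩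
  have hopen : IsOpenMap (toComponent hf hα e₀) :=
    (isLocalHomeomorph_toComponent hf hα hq.isCoveringMap hq.surjective e₀).isOpenMap
  exact ⟨(Equiv.ofBijective _ hbij).toHomeomorphOfContinuousOpen
    (toComponent hf hα e₀).continuous hopen, fun _ => rfl⟩

/-- `α` and a suitable permutation of it identify `E` with one and the same component, in such a
way that `e` and `e'` correspond. -/
theorem exists_deck_smul_eq (hf : IsWeierstrass f n) (hq : IsSplittingCovering q f n) {e e' : E}
    (h : q e = q e') : ∃ Φ : deck q, Φ • e' = e := by
  have := hq.pathConnected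
  obtain ⟨α, hα⟩ := hq.splits
  obtain ⟨σ, hσ⟩ := exists_perm_ofRoots_eq hf hα
    (h.symm.trans (proj_ofRoots hf hα e).symm)
  obtain ⟨Ψ, hΨ⟩ := hq.exists_homeomorph_component hf hα (e₀ := e) rfl
  obtain ⟨Ψ', hΨ'⟩ := hq.exists_homeomorph_component hf (hα.comp_perm σ) hσ
  have hq_eq (y : E) : q (Ψ.symm (Ψ' y)) = q y := by
    rw [← proj_ofRoots hf hα, ← hΨ, Ψ.apply_symm_apply, hΨ', proj_ofRoots]
  refine ⟨⟨Ψ'.trans Ψ.symm, hq_eq⟩, Ψ.injective (Subtype.ext ?_)⟩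
  rw [deck_smul_def, Homeomorph.trans_apply, Ψ.apply_symm_apply, hΨ, hΨ', hσ]

theorem isQuotientCoveringMap (hf : IsWeierstrass f n) (hq : IsSplittingCovering q f n) :
    IsQuotientCoveringMap q (deck q) := by
  have := hq.pathConnected
  exact isQuotientCoveringMap_deck hq.isCoveringMap hq.surjective (hq.exists_deck_smul_eq hf)

theorem finite_deck (hf : IsWeierstrass f n) (hq : IsSplittingCovering q f n) :
    Finite (deck q) := by
  have := hq.pathConnected
  obtain ⟨e⟩ := (inferInstance : Nonempty E)
  have : Finite (q ⁻¹' {q e}) := hq.finite_fiber hf (q e)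
  exact .of_equiv _ ((hq.isQuotientCoveringMap hf).fiberEquivGroup ⟨e, rfl⟩)

end IsSplittingCovering

end Splitting

/-! ### Intermediate coverings and subgroups -/

namespace IntermediateCovering

variable {X E : Type u} [TopologicalSpace X] [TopologicalSpace E] {q : C(E, X)} {e₀ : E}

theorem toBase_fromTop (L : IntermediateCovering q e₀) (e : E) :
    L.toBase (L.fromTop e) = q e :=
  DFunLike.congr_fun L.comp_eq e

theorem mem_deckOver {L : IntermediateCovering q e₀} {Φ : deck q} :
    Φ ∈ L.deckOver ↔ ∀ e, L.fromTop (Φ • e) = L.fromTop e := Iff.rfl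

theorem surjective_fromTop (L : IntermediateCovering q e₀) : Function.Surjective L.fromTop :=
  have : Nonempty E := ⟨e₀⟩
  surjective_of_isCoveringMap L.isCoveringMap_fromTop

theorem isQuotientMap_fromTop (L : IntermediateCovering q e₀) : IsQuotientMap L.fromTop :=
  L.isCoveringMap_fromTop.isQuotientMap L.surjective_fromTop

theorem deckOver_self (hE : PathConnectedSpace E) (hq : IsCoveringMap q) :
    (self e₀ hE hq).deckOver = ⊥ :=
  (Subgroup.eq_bot_iff_forall _).2 fun _ hΦ => deck_ext hq (mem_deckOver.1 hΦ e₀)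

theorem deckOver_base [PathConnectedSpace X] (hq : IsCoveringMap q) :
    (base e₀ hq).deckOver = ⊤ :=
  eq_top_iff.2 fun Φ _ => mem_deckOver.2 (map_deck_smul Φ)

section Preconnected

variable [PreconnectedSpace E] {L M : IntermediateCovering q e₀}

theorem fromTop_smul_eq_iff {Φ : deck q} {e : E} :
    L.fromTop (Φ • e) = L.fromTop e ↔ Φ ∈ L.deckOver := by
  refine ⟨fun h => mem_deckOver.2 fun y => ?_, fun h => mem_deckOver.1 h e⟩
  exact congrFun (L.isCoveringMap_toBase.eq_of_comp_eq
    (L.fromTop.continuous.comp (continuous_const_smul Φ)) L.fromTop.continuous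
    (funext fun y => by simp [toBase_fromTop, map_deck_smul]) e h) y

theorem fromTop_smul_eq_iff_mem_subgroupOf (Φ : M.deckOver) (e : E) :
    L.fromTop (Φ • e) = L.fromTop e ↔ Φ ∈ L.deckOver.subgroupOf M.deckOver :=
  fromTop_smul_eq_iff.trans Subgroup.mem_subgroupOf.symm

theorem isQuotientCoveringMap_fromTop (hq : IsQuotientCoveringMap q (deck q)) :
    IsQuotientCoveringMap L.fromTop L.deckOver := by
  refine isQuotientCoveringMap_subgroup hq L.isQuotientMap_fromTop fun {e e'} => ?_
  constructor
  · intro h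
    obtain ⟨Φ, rfl⟩ := hq.apply_eq_iff_mem_orbit.1
      (by rw [← L.toBase_fromTop, h, L.toBase_fromTop] : q e = q e')
    exact ⟨⟨Φ, fromTop_smul_eq_iff.1 h⟩, rfl⟩
  · rintro ⟨Φ, rfl⟩
    exact fromTop_smul_eq_iff.2 Φ.2

namespace IsCoveringOver

variable {s : C(L.carrier, M.carrier)}

theorem comp_fromTop (hs : L.IsCoveringOver M s) : s ∘ L.fromTop = M.fromTop := by
  refine M.isCoveringMap_toBase.eq_of_comp_eq (s.continuous.comp L.fromTop.continuous)
    M.fromTop.continuous (funext fun e => ?_) e₀ ?_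
  · have := DFunLike.congr_fun hs.comp_eq (L.fromTop e)
    simpa [toBase_fromTop] using this
  · simp [L.map_point, M.map_point, hs.map_point]

theorem apply_fromTop (hs : L.IsCoveringOver M s) (e : E) : s (L.fromTop e) = M.fromTop e :=
  congrFun hs.comp_fromTop e

theorem deckOver_le (hs : L.IsCoveringOver M s) : L.deckOver ≤ M.deckOver := by
  refine fun Φ hΦ => mem_deckOver.2 fun e => ?_
  rw [← hs.apply_fromTop, ← hs.apply_fromTop, mem_deckOver.1 hΦ]

theorem ncard_fiber (hs : L.IsCoveringOver M s) (hq : IsQuotientCoveringMap q (deck q))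
    (m : M.carrier) : (s ⁻¹' {m}).ncard = L.deckOver.relIndex M.deckOver :=
  card_fiber_eq_index (isQuotientCoveringMap_fromTop hq) L.surjective_fromTop
    fromTop_smul_eq_iff_mem_subgroupOf hs.comp_fromTop m

theorem finite_fiber [Finite (deck q)] (hs : L.IsCoveringOver M s)
    (hq : IsQuotientCoveringMap q (deck q)) (m : M.carrier) : (s ⁻¹' {m}).Finite :=
  Set.finite_of_ncard_ne_zero (hs.ncard_fiber hq m ▸ Subgroup.index_ne_zero_of_finite)

end IsCoveringOver

theorem exists_isCoveringOver_iff (hq : IsQuotientCoveringMap q (deck q))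
    (L M : IntermediateCovering q e₀) :
    (∃ s, L.IsCoveringOver M s) ↔ L.deckOver ≤ M.deckOver := by
  refine ⟨fun ⟨s, hs⟩ => hs.deckOver_le, fun hLM => ?_⟩
  have hL := isQuotientCoveringMap_fromTop (L := L) hq
  have hcomp (e e' : E) (he : L.fromTop e = L.fromTop e') : M.fromTop e = M.fromTop e' := by
    obtain ⟨Φ, rfl⟩ := hL.apply_eq_iff_mem_orbit.1 he
    exact mem_deckOver.1 (hLM Φ.2) e'
  let s : C(L.carrier, M.carrier) := L.isQuotientMap_fromTop.lift M.fromTop hcomp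
  have hs : s ∘ L.fromTop = M.fromTop :=
    congrArg DFunLike.coe (L.isQuotientMap_fromTop.lift_comp M.fromTop hcomp)
  refine ⟨s, ?_, ContinuousMap.ext fun l => ?_, ?_⟩
  · exact isCoveringMap_of_comp_eq (isQuotientCoveringMap_fromTop hq) hL.isOpenQuotientMap
      fromTop_smul_eq_iff_mem_subgroupOf hs
  · obtain ⟨e, rfl⟩ := L.surjective_fromTop l
    exact (congrArg M.toBase (congrFun hs e)).trans
      ((M.toBase_fromTop e).trans (L.toBase_fromTop e).symm)
  · rw [← L.map_point, ← M.map_point]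
    exact congrFun hs e₀

theorem Iso.deckOver_le (h : Iso L M) : L.deckOver ≤ M.deckOver := by
  obtain ⟨h, hbase, hpoint⟩ := h
  exact IsCoveringOver.deckOver_le (s := (h : C(L.carrier, M.carrier)))
    ⟨(isCoveringMap_id M.carrier).comp_homeomorph h, ContinuousMap.ext hbase, hpoint⟩

theorem iso_iff (hq : IsQuotientCoveringMap q (deck q)) : Iso L M ↔ L.deckOver = M.deckOver := by
  refine ⟨fun h => le_antisymm h.deckOver_le ((isoSetoid q e₀).symm h : Iso M L).deckOver_le,
    fun h => ?_⟩
  obtain ⟨s, hs⟩ := (exists_isCoveringOver_iff hq L M).2 h.le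
  obtain ⟨t, ht⟩ := (exists_isCoveringOver_iff hq M L).2 h.ge
  refine ⟨⟨⟨s, t, fun l => ?_, fun m => ?_⟩, s.continuous, t.continuous⟩,
    DFunLike.congr_fun hs.comp_eq, hs.map_point⟩
  · obtain ⟨e, rfl⟩ := L.surjective_fromTop l
    rw [hs.apply_fromTop, ht.apply_fromTop]
  · obtain ⟨e, rfl⟩ := M.surjective_fromTop m
    rw [ht.apply_fromTop, hs.apply_fromTop]

end Preconnected

section Quotient

variable (hq : IsQuotientCoveringMap q (deck q)) (H : Subgroup (deck q))

include hq in
theorem isQuotientCoveringMap_mk :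
    IsQuotientCoveringMap (Quotient.mk (MulAction.orbitRel H E)) H :=
  isQuotientCoveringMap_subgroup hq isQuotientMap_quotient_mk' Quotient.eq

include hq in
theorem mk_smul_eq_iff {H : Subgroup (deck q)} (Φ : deck q) (e : E) :
    Quotient.mk (MulAction.orbitRel H E) (Φ • e) = Quotient.mk _ e ↔ Φ ∈ H := by
  have := hq.isCancelSMul
  rw [Quotient.eq]
  constructor
  · rintro ⟨Ψ, hΨ⟩
    exact IsCancelSMul.right_cancel (Ψ : deck q) Φ e hΨ ▸ Ψ.2
  · exact fun hΦ => ⟨⟨Φ, hΦ⟩, rfl⟩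

variable [PathConnectedSpace E] (e₀ : E)

/-- The intermediate covering `E → E/H → X`. -/
def quotient : IntermediateCovering q e₀ where
  carrier := MulAction.orbitRel.Quotient H E
  pathConnected := Quotient.mk_surjective.pathConnectedSpace continuous_quotient_mk'
  point := Quotient.mk _ e₀
  fromTop := ⟨Quotient.mk _, continuous_quotient_mk'⟩
  toBase := ⟨Quotient.lift q fun _ _ ⟨Φ, hΦ⟩ => hΦ ▸ map_deck_smul (Φ : deck q) _,
    continuous_quot_lift _ q.continuous⟩
  isCoveringMap_fromTop := (isQuotientCoveringMap_mk hq H).isCoveringMap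
  isCoveringMap_toBase := isCoveringMap_of_comp_eq hq
    (isQuotientCoveringMap_mk hq H).isOpenQuotientMap (mk_smul_eq_iff hq) rfl
  comp_eq := rfl
  map_point := rfl

@[simp]
theorem deckOver_quotient : (quotient hq H e₀).deckOver = H := by
  ext Φ
  exact (fromTop_smul_eq_iff (e := e₀)).symm.trans (mk_smul_eq_iff hq Φ e₀)

/-- The correspondence between isomorphism classes of intermediate coverings and subgroups of the
group of covering transformations. -/
def isoClassEquiv : Quotient (isoSetoid q e₀) ≃ Subgroup (deck q) where
  toFun := Quotient.lift deckOver fun _ _ h => (iso_iff hq).1 h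
  invFun H := Quotient.mk _ (quotient hq H e₀)
  left_inv := by
    rintro ⟨L⟩
    exact Quotient.sound ((iso_iff hq).2 (deckOver_quotient hq L.deckOver e₀))
  right_inv H := deckOver_quotient hq H e₀

end Quotient

end IntermediateCovering

/-! ### The isomorphism `ω` -/

theorem eq_zero_or_one_of_isIdempotentElem {Y R : Type*} [TopologicalSpace Y]
    [PreconnectedSpace Y] [MonoidWithZero R] [IsLeftCancelMulZero R] [TopologicalSpace R]
    [ContinuousMul R] [T1Space R] {β : C(Y, R)} (h : IsIdempotentElem β) : β = 0 ∨ β = 1 := by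
  have hβ (y : Y) : β y = 0 ∨ β y = 1 :=
    IsIdempotentElem.iff_eq_zero_or_one.1 (DFunLike.congr_fun h y)
  by_contra! ⟨h0, h1⟩
  obtain ⟨y, hy⟩ := DFunLike.ne_iff.1 h0
  obtain ⟨z, hz⟩ := DFunLike.ne_iff.1 h1
  have hyz : β y = β z := isPreconnected_univ.constant_of_mapsTo
    (Set.toFinite ({0, 1} : Set R)).isDiscrete β.continuous.continuousOn (fun x _ => hβ x)
    trivial trivial
  exact hz (hyz ▸ (hβ y).resolve_left hy)

section Roots

variable {X E : Type*} [TopologicalSpace X] [TopologicalSpace E] {f : C(X, ℂ)[X]} {n : ℕ}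
  {q : C(E, X)} {T : Subring C(E, ℂ)} {α : Fin n → C(E, ℂ)}

theorem adjoinRoots_eq_zero_or_one [PreconnectedSpace E] {β : adjoinRoots T α}
    (h : IsIdempotentElem β) : β = 0 ∨ β = 1 :=
  (eq_zero_or_one_of_isIdempotentElem (h.map (adjoinRoots T α).val)).imp Subtype.ext Subtype.ext

variable (T α) in
/-- The root `α i` as an element of `T[α]`. -/
def adjoinedRoot (i : Fin n) : adjoinRoots T α := ⟨α i, Algebra.subset_adjoin ⟨i, rfl⟩⟩

theorem autGroup_ext {φ ψ : autGroup T α}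
    (h : ∀ i, φ (adjoinedRoot T α i) = ψ (adjoinedRoot T α i)) : φ = ψ := by
  refine AlgEquiv.coe_toAlgHom_injective (AlgHom.adjoin_ext ?_)
  rintro _ ⟨i, rfl⟩
  exact h i

theorem isFunRoot_autGroup (hα : IsRootList q f α) (hcoeff : ∀ i, pullback q (f.coeff i) ∈ T)
    (φ : autGroup T α) (i : Fin n) :
    IsFunRoot (f.map (pullback q)) (φ (adjoinedRoot T α i) : C(E, ℂ)) := by
  have hmem : ((f.map (pullback q)).coeffs : Set C(E, ℂ)) ⊆ T := by
    intro c hc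
    obtain ⟨i, -, rfl⟩ := mem_coeffs_iff.1 (Finset.mem_coe.1 hc)
    exact coeff_map (pullback q) i ▸ hcoeff i
  let F : T[X] := (f.map (pullback q)).toSubring T hmem
  have isFunRoot_iff_aeval (β : adjoinRoots T α) :
      IsFunRoot (f.map (pullback q)) (β : C(E, ℂ)) ↔ aeval β F = 0 := by
    rw [isFunRoot_iff, ← map_toSubring (f.map (pullback q)) T hmem, ← Subtype.coe_inj,
      ← Subalgebra.aeval_coe]
    exact (eval_map_algebraMap F (β : C(E, ℂ))).congr_left
  rw [isFunRoot_iff_aeval, aeval_algHom_apply, (isFunRoot_iff_aeval _).1 (hα.isFunRoot i),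
    map_zero]

theorem isUnit_Delta_adjoinedRoot (hΔ : ∃ δ ∈ adjoinRoots T α, Delta α * δ = 1) :
    IsUnit (Delta (adjoinedRoot T α)) := by
  obtain ⟨δ, hδ, h⟩ := hΔ
  have hcoe : ((Delta (adjoinedRoot T α) : adjoinRoots T α) : C(E, ℂ)) = Delta α :=
    map_Delta (adjoinRoots T α).val.toRingHom (adjoinedRoot T α)
  exact IsUnit.of_mul_eq_one ⟨δ, hδ⟩ (Subtype.ext ((congrArg (· * δ) hcoe).trans h))

theorem exists_indicates_adjoinRoots [ConnectedSpace E] [Finite (autGroup T α)]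
    (hf : IsWeierstrass f n) (hα : IsRootList q f α) (hcoeff : ∀ i, pullback q (f.coeff i) ∈ T)
    (hΔ : ∃ δ ∈ adjoinRoots T α, Delta α * δ = 1) :
    ∃ w : adjoinRoots T α ⊗[T] adjoinRoots T α,
      Indicates (T := T) (A := adjoinRoots T α) (S := adjoinRoots T α)
        (AlgHom.id T (adjoinRoots T α)) (⊥ : Subgroup (autGroup T α)) w := by
  refine exists_indicates_bot (T := T) (S := adjoinRoots T α) fun (φ : autGroup T α) hφ => ?_
  obtain ⟨i, hi⟩ : ∃ i, φ (adjoinedRoot T α i) ≠ adjoinedRoot T α i := by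
    by_contra! h
    exact hφ (autGroup_ext h)
  obtain ⟨j, hj⟩ := hα.exists_eq hf (isFunRoot_autGroup hα hcoeff φ i)
  have hφj : φ (adjoinedRoot T α i) = adjoinedRoot T α j := Subtype.ext hj.symm
  have hij : i ≠ j := fun hij => hi (hφj.trans (congrArg _ hij.symm))
  refine ⟨adjoinedRoot T α i, ?_⟩
  rw [AlgEquiv.smul_def, hφj]
  exact isUnit_sub_of_isUnit_Delta (isUnit_Delta_adjoinedRoot hΔ) hij

end Roots

section Omega

variable {X E : Type*} [TopologicalSpace X] [TopologicalSpace E] {f : C(X, ℂ)[X]} {n : ℕ}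
  {q : C(E, X)} {T : Subring C(E, ℂ)} {α : Fin n → C(E, ℂ)}

/-- The action `β ↦ β ∘ Φ⁻¹` of a covering transformation on `C(E)`; it fixes `T ⊆ q* C(X)`. -/
def deckAlgHom (hT : T ≤ (pullback q).range) (Φ : deck q) : C(E, ℂ) →ₐ[T] C(E, ℂ) :=
  { pullback ((Φ : E ≃ₜ E).symm : C(E, E)) with
    commutes' := fun t => by
      obtain ⟨γ, hγ⟩ := hT t.2
      ext y
      change (t : C(E, ℂ)) (Φ⁻¹ • y) = (t : C(E, ℂ)) y
      rw [← hγ]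
      exact congrArg γ (map_deck_smul Φ⁻¹ y) }

theorem deckAlgHom_apply (hT : T ≤ (pullback q).range) (Φ : deck q) (β : C(E, ℂ)) (y : E) :
    deckAlgHom hT Φ β y = β (Φ⁻¹ • y) := rfl

theorem isFunRoot_deckAlgHom (hα : IsRootList q f α) (hT : T ≤ (pullback q).range) (Φ : deck q)
    (i : Fin n) : IsFunRoot (f.map (pullback q)) (deckAlgHom hT Φ (α i)) := by
  refine isFunRoot_map_iff.2 fun y => ?_
  rw [deckAlgHom_apply, ← map_deck_smul Φ⁻¹ y]
  exact hα.eval_eq_zero i _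

theorem mem_range_pullback_of_forall_smul_eq (hq : IsQuotientCoveringMap q (deck q))
    {β : C(E, ℂ)} (hβ : ∀ (Φ : deck q) (y : E), β (Φ • y) = β y) : β ∈ (pullback q).range := by
  have hconst (e e' : E) (h : q e = q e') : β e = β e' := by
    obtain ⟨Φ, rfl⟩ := hq.apply_eq_iff_mem_orbit.1 h
    exact hβ Φ e'
  have hquot := hq.isOpenQuotientMap.isQuotientMap
  exact ⟨hquot.lift β hconst, hquot.lift_comp β hconst⟩

section Connected

variable [ConnectedSpace E] (hf : IsWeierstrass f n) (hα : IsRootList q f α)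
  (hT : T ≤ (pullback q).range)

include hf hα in
theorem deckAlgHom_mem (Φ : deck q) {β : C(E, ℂ)} (hβ : β ∈ adjoinRoots T α) :
    deckAlgHom hT Φ β ∈ adjoinRoots T α := by
  have hle : (adjoinRoots T α).map (deckAlgHom hT Φ) ≤ adjoinRoots T α := by
    rw [AlgHom.map_adjoin, Algebra.adjoin_le_iff]
    rintro _ ⟨_, ⟨i, rfl⟩, rfl⟩
    obtain ⟨j, hj⟩ := hα.exists_eq hf (isFunRoot_deckAlgHom hα hT Φ i)
    exact Algebra.subset_adjoin ⟨j, hj⟩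
  exact hle ⟨β, hβ, rfl⟩

/-- The action of the covering transformations on `T[α]` by endomorphisms. -/
def deckRestrict : deck q →* (adjoinRoots T α →ₐ[T] adjoinRoots T α) where
  toFun Φ := ((deckAlgHom hT Φ).comp (adjoinRoots T α).val).codRestrict (adjoinRoots T α)
    fun β => deckAlgHom_mem hf hα hT Φ β.2
  map_one' := rfl
  map_mul' _ _ := rfl

/-- The homomorphism `ω : A(E/X) → Aut_T T[α]`, `ω(Φ)(β) = β ∘ Φ⁻¹`. -/
def omegaHom : deck q →* autGroup T α :=
  (AlgEquiv.algHomUnitsEquiv T (adjoinRoots T α)).toMonoidHom.comp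
    (deckRestrict hf hα hT).toHomUnits

theorem omegaHom_apply (Φ : deck q) (β : adjoinRoots T α) (y : E) :
    (omegaHom hf hα hT Φ β : C(E, ℂ)) y = (β : C(E, ℂ)) (Φ⁻¹ • y) := rfl

theorem mem_range_algebraMap_of_forall_omegaHom_eq (hq : IsQuotientCoveringMap q (deck q))
    (hinv : (adjoinRoots T α : Set C(E, ℂ)) ∩ (pullback q).range = T) {β : adjoinRoots T α}
    (hβ : ∀ Φ : deck q, omegaHom hf hα hT Φ β = β) : ∃ t : T, algebraMap T _ t = β := by
  have hmem : (β : C(E, ℂ)) ∈ (pullback q).range :=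
    mem_range_pullback_of_forall_smul_eq hq fun Φ y => by
      rw [← inv_inv Φ, ← omegaHom_apply hf hα hT, hβ]
  exact ⟨⟨β, hinv.le ⟨β.2, hmem⟩⟩, rfl⟩

include hf hα hT in
theorem isInvariant_autGroup (hq : IsQuotientCoveringMap q (deck q))
    (hinv : (adjoinRoots T α : Set C(E, ℂ)) ∩ (pullback q).range = T) :
    Algebra.IsInvariant T (adjoinRoots T α) (autGroup T α) :=
  ⟨fun _ hβ => mem_range_algebraMap_of_forall_omegaHom_eq hf hα hT hq hinv
    fun Φ => hβ (omegaHom hf hα hT Φ)⟩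

theorem omegaHom_surjective [Finite (deck q)] (hq : IsQuotientCoveringMap q (deck q))
    (hcoeff : ∀ i, pullback q (f.coeff i) ∈ T)
    (hinv : (adjoinRoots T α : Set C(E, ℂ)) ∩ (pullback q).range = T) :
    Function.Surjective (omegaHom hf hα hT) := by
  intro φ
  obtain ⟨e⟩ := (inferInstance : Nonempty E)
  let D := (omegaHom hf hα hT).range
  have : Finite D := .of_surjective _ (omegaHom hf hα hT).rangeRestrict_surjective
  let evalAt : adjoinRoots T α →+* ℂ :=
    (ContinuousMap.evalAlgHom ℂ ℂ e : C(E, ℂ) →ₐ[ℂ] ℂ).toRingHom.comp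
      (adjoinRoots T α).val.toRingHom
  have heq (β : adjoinRoots T α) (hβ : ∀ ψ : D, ψ • β = β) :
      evalAt β = evalAt.comp (φ : adjoinRoots T α →+* adjoinRoots T α) β := by
    obtain ⟨t, rfl⟩ := mem_range_algebraMap_of_forall_omegaHom_eq hf hα hT hq hinv
      fun Φ => hβ ⟨_, Φ, rfl⟩
    simp
  obtain ⟨⟨_, Φ, rfl⟩, hΦ⟩ := exists_forall_eq_of_eq_on_invariants heq (adjoinedRoot T α)
  refine ⟨Φ, autGroup_ext fun i => Subtype.ext ?_⟩
  exact hf.eq_of_apply_eq (isFunRoot_deckAlgHom hα hT Φ i) (isFunRoot_autGroup hα hcoeff φ i)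
    (hΦ i).symm

end Connected

end Omega

section SplittingCovering

variable {X E : Type u} [TopologicalSpace X] [TopologicalSpace E] [PathConnectedSpace X]
  [LocallyPathConnectedSpace X] [ConnectedSpace E] {f : C(X, ℂ)[X]} {n : ℕ} {q : C(E, X)}
  {T : Subring C(E, ℂ)} {α : Fin n → C(E, ℂ)}
  (hf : IsWeierstrass f n) (hq : IsSplittingCovering q f n) (hα : IsRootList q f α)
  (hT : T ≤ (pullback q).range)

include hq in
theorem omegaHom_injective : Function.Injective (omegaHom hf hα hT) := by
  obtain ⟨e⟩ := (inferInstance : Nonempty E)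
  refine (injective_iff_map_eq_one _).2 fun Φ hΦ => inv_eq_one.1 ?_
  refine deck_ext (e := e) hq.isCoveringMap ?_
  refine (hq.eq_of_roots_eq hf hα (map_deck_smul Φ⁻¹ e) fun i => ?_).trans (one_smul _ e).symm
  rw [← show _ = α i (Φ⁻¹ • e) from omegaHom_apply hf hα hT Φ (adjoinedRoot T α i) e, hΦ]
  rfl

variable (hcoeff : ∀ i, pullback q (f.coeff i) ∈ T)
  (hinv : (adjoinRoots T α : Set C(E, ℂ)) ∩ (pullback q).range = T)

/-- The isomorphism `ω : A(E/X) ≃ Aut_T T[α]`. -/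
def omega : deck q ≃* autGroup T α :=
  have := hq.finite_deck hf
  MulEquiv.ofBijective (omegaHom hf hα hT) ⟨omegaHom_injective hf hq hα hT,
    omegaHom_surjective hf hα hT (hq.isQuotientCoveringMap hf) hcoeff hinv⟩

theorem isOmega_omega : IsOmega q T α (omega hf hq hα hT hcoeff hinv) := fun _ _ _ => rfl

include hf hq hα hT hcoeff hinv in
theorem finite_autGroup : Finite (autGroup T α) :=
  have := hq.finite_deck hf
  .of_equiv _ (omega hf hq hα hT hcoeff hinv).toEquiv

end SplittingCovering

theorem relIndex_mapSubgroup {G G' : Type*} [Group G] [Group G'] (ω : G ≃* G')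
    (H K : Subgroup G) : (ω.mapSubgroup H).relIndex (ω.mapSubgroup K) = H.relIndex K :=
  Subgroup.relIndex_map_map_of_injective (f := ω.toMonoidHom) H K ω.injective

end SemiTopGalois

end

theorem mainTheorem1_general {X E : Type u} [TopologicalSpace X] [TopologicalSpace E]
    [PathConnectedSpace X] [LocallyPathConnectedSpace X]
    {n : ℕ} (f : Polynomial C(X, ℂ)) (hf : IsWeierstrass f n)
    (q : C(E, X)) (hq : IsSplittingCovering q f n) (e₀ : E)
    (α : Fin n → C(E, ℂ)) (hα : IsRootList q f α) :
    (∀ T : Subring C(E, ℂ), T ≤ (pullback q).range →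
      (∀ i, pullback q (f.coeff i) ∈ T) →
      (adjoinRoots T α : Set C(E, ℂ)) ∩ (pullback q).range = T →
      (∃ δ ∈ adjoinRoots T α, Delta α * δ = 1) →
      ∃ ω : deck q ≃* autGroup T α, IsOmega q T α ω ∧
      ∃ κ : Quotient (IntermediateCovering.isoSetoid q e₀) ≃ Subgroup (deck q),
        (∀ L : IntermediateCovering q e₀, κ (Quotient.mk _ L) = L.deckOver) ∧
        (∀ L M : IntermediateCovering q e₀,
          (∃ s, L.IsCoveringOver M s) ↔ L.deckOver ≤ M.deckOver) ∧
      ∃ ν : Subgroup (deck q) ≃o Subgroup (autGroup T α),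
        (∀ H, ν H = H.map ω.toMonoidHom) ∧
      ∃ fix : Subgroup (autGroup T α) ≃o
          (SepSubalgebra T (adjoinRoots T α))ᵒᵈ,
        (∀ H', (OrderDual.ofDual (fix H')).1 =
          FixedPoints.subalgebra T (adjoinRoots T α) H') ∧
        (∀ S : SepSubalgebra T (adjoinRoots T α),
          fix.symm (OrderDual.toDual S) =
            fixingSubgroup (autGroup T α) (S.1 : Set (adjoinRoots T α))) ∧
        (IntermediateCovering.self e₀ hq.pathConnected hq.isCoveringMap).deckOver = ⊥ ∧
        (IntermediateCovering.base e₀ hq.isCoveringMap).deckOver = ⊤ ∧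
        (OrderDual.ofDual (fix ⊥)).1 = ⊤ ∧
        (OrderDual.ofDual (fix ⊤)).1 = ⊥ ∧
        ∀ (L M : IntermediateCovering q e₀) (s : C(L.carrier, M.carrier)),
          L.IsCoveringOver M s → ∀ m : M.carrier,
            (s ⁻¹' {m}).Finite ∧
            (s ⁻¹' {m}).ncard = L.deckOver.relIndex M.deckOver ∧
            L.deckOver.relIndex M.deckOver = (ν L.deckOver).relIndex (ν M.deckOver)) ∧
    (∃ ω : deck q ≃* autGroup (pullback q).range α, IsOmega q (pullback q).range α ω) := by
  have := hq.pathConnected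
  have hqc := hq.isQuotientCoveringMap hf
  have := hq.finite_deck hf
  refine ⟨fun T hT hcoeff hinv hΔ => ?_, ?_⟩
  · have := finite_autGroup hf hq hα hT hcoeff hinv
    have := isInvariant_autGroup hf hα hT hqc hinv
    obtain ⟨w, hw⟩ := exists_indicates_adjoinRoots hf hα hcoeff hΔ
    let ω := omega hf hq hα hT hcoeff hinv
    let fix := galoisCorrespondence (fun β : adjoinRoots T α => adjoinRoots_eq_zero_or_one) hw
    exact ⟨ω, isOmega_omega hf hq hα hT hcoeff hinv,
      IntermediateCovering.isoClassEquiv hqc e₀, fun _ => rfl,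
      IntermediateCovering.exists_isCoveringOver_iff hqc,
      ω.mapSubgroup, fun _ => rfl, fix, fun _ => rfl, fun _ => rfl,
      IntermediateCovering.deckOver_self _ _, IntermediateCovering.deckOver_base _,
      galoisCorrespondence_bot _ hw, galoisCorrespondence_top _ hw,
      fun L M s hs m => ⟨hs.finite_fiber hqc m, hs.ncard_fiber hqc m,
        (relIndex_mapSubgroup ω L.deckOver M.deckOver).symm⟩⟩
  · have hinv : (adjoinRoots (pullback q).range α : Set C(E, ℂ)) ∩ (pullback q).range =
        (pullback q).range :=
      Set.inter_eq_right.2 fun β hβ => (adjoinRoots _ α).algebraMap_mem ⟨β, hβ⟩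
    exact ⟨_, isOmega_omega hf hq hα le_rfl (fun i => ⟨f.coeff i, rfl⟩) hinv⟩

theorem mainTheorem1 {X E : Type u} [TopologicalSpace X] [TopologicalSpace E]
    [T2Space X] [PathConnectedSpace X] [LocallyPathConnectedSpace X]
    (hX : SemilocallySimplyConnected X)
    {n : ℕ} (f : Polynomial C(X, ℂ)) (hf : IsWeierstrass f n)
    (q : C(E, X)) (hq : IsSplittingCovering q f n) (e₀ : E)
    (α : Fin n → C(E, ℂ)) (hα : IsRootList q f α) :
    (∀ T : Subring C(E, ℂ), T ≤ (pullback q).range →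
      (∀ i, pullback q (f.coeff i) ∈ T) →
      (adjoinRoots T α : Set C(E, ℂ)) ∩ (pullback q).range = T →
      (∃ δ ∈ adjoinRoots T α, Delta α * δ = 1) →
      -- the isomorphism `ω`
      ∃ ω : deck q ≃* autGroup T α, IsOmega q T α ω ∧
      -- intermediate coverings and subgroups of `A(E/X)`
      ∃ κ : Quotient (IntermediateCovering.isoSetoid q e₀) ≃ Subgroup (deck q),
        (∀ L : IntermediateCovering q e₀, κ (Quotient.mk _ L) = L.deckOver) ∧
        (∀ L M : IntermediateCovering q e₀,
          (∃ s, L.IsCoveringOver M s) ↔ L.deckOver ≤ M.deckOver) ∧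
      -- subgroups of `A(E/X)` and subgroups of `G = Aut_T T[α]`
      ∃ ν : Subgroup (deck q) ≃o Subgroup (autGroup T α),
        (∀ H, ν H = H.map ω.toMonoidHom) ∧
      -- subgroups of `G` and separable `T`-subalgebras of `T[α]`
      ∃ fix : Subgroup (autGroup T α) ≃o
          (SepSubalgebra T (adjoinRoots T α))ᵒᵈ,
        (∀ H', (OrderDual.ofDual (fix H')).1 =
          FixedPoints.subalgebra T (adjoinRoots T α) H') ∧
        (∀ S : SepSubalgebra T (adjoinRoots T α),
          fix.symm (OrderDual.toDual S) =
            fixingSubgroup (autGroup T α) (S.1 : Set (adjoinRoots T α))) ∧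
      -- the extreme rows
        (IntermediateCovering.self e₀ hq.pathConnected hq.isCoveringMap).deckOver = ⊥ ∧
        (IntermediateCovering.base e₀ hq.isCoveringMap).deckOver = ⊤ ∧
        (OrderDual.ofDual (fix ⊥)).1 = ⊤ ∧
        (OrderDual.ofDual (fix ⊤)).1 = ⊥ ∧
      -- degrees and indices
        ∀ (L M : IntermediateCovering q e₀) (s : C(L.carrier, M.carrier)),
          L.IsCoveringOver M s → ∀ m : M.carrier,
            (s ⁻¹' {m}).Finite ∧
            (s ⁻¹' {m}).ncard = L.deckOver.relIndex M.deckOver ∧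
            L.deckOver.relIndex M.deckOver = (ν L.deckOver).relIndex (ν M.deckOver)) ∧
    -- the semi-topological Galois group `G_f = Aut_R R[α]`, `R = q* C(X)`
    (∃ ω : deck q ≃* autGroup (pullback q).range α, IsOmega q (pullback q).range α ω) :=
  mainTheorem1_general f hf q hq e₀ α hα
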